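/- **Setting.** A *network* $\mathcal G$ has a finite set of nodes $\mathcal C$ and a finite set of arrows $\mathcal A$, an equivalence relation "same type" on each of them, and a head node $\mathcal H(a)$ and a tail node $\mathcal T(a)$ for each arrow $a$ (loops and multiple arrows are allowed). Let $I(c)=\{a:\mathcal H(a)=c\}$. An *input isomorphism* from $c$ to $d$ is an arrow-type preserving bijection $\beta:I(c)\to I(d)$, where $c,d$ have the same node-type; $B(c,d)$ is the set of these, and $c,d$ are *input isomorphic* if $B(c,d)\neq\emptyset$. Nodes have state spaces $P_c=\mathbb R^{k_c}$, $k_c\ge 1$, and $P=\prod_c P_c$ has the norm $\max_c\|x_c\|_{\mathrm{Euclid}}$. An equality $x_c=x_d$ of node states includes $k_c=k_d$. A map $f:P\to P$ is *admissible* if, for all $\beta\in B(c,d)$, $P_c=P_d$ and $P_{\mathcal T(a)}=P_{\mathcal T(\beta(a))}$ for $a\in I(c)$, and if there are maps $\hat f_c$ with $f_c(x)=\hat f_c(x_c,(x_{\mathcal T(a)})_{a\in I(c)})$ and $\hat f_d(z,w)=\hat f_c(z,(w_{\beta(a)})_{a\in I(c)})$ for all $\beta\in B(c,d)$. Let $\|p\|_1=\sup_x\max(\|p(x)\|,\|\mathrm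 Dp(x)\|)$. A periodic orbit is a nonconstant solution $x:\mathbb R\to P$ with $x(t+T)=x(t)$, $T>0$; it is *hyperbolic* if all Floquet multipliers are off the unit circle except for a simple multiplier $1$. **Rigidity.** Let $f$ be an admissible $C^\infty$ map and $x$ a hyperbolic periodic orbit of $\dot x=f(x)$ with period $T$. For a small admissible $C^\infty$ map $p$ let $\tilde x$, with period $\tilde T$ near $T$, be the periodic orbit of $f+p$ near $x$, its phase fixed by requiring $\tilde x(t_0)$ to lie in a fixed Poincaré section at $x(t_0)$. * A colouring (equivalence relation) $\bowtie$ of $\mathcal C$ is a *locally rigid synchrony pattern* at $t_0\in\mathbb R$ if there are $\varepsilon,t^*>0$ such that, for all admissible $C^\infty$ maps $p$ with $\|p\|_1<\varepsilon$, the orbit $\tilde x$ is hyperbolic and $\tilde x_c(t)=\tilde x_d(t)\iff c\bowtie d$ whenever $|t-t_0|<t^*$. * Nodes $c,d$ are *locally rigidly phase-related* at $t_0$ by $\theta\in\mathbb R$ if there are $\varepsilon,t^*>0$ such that, for all such $p$, the orbit $\tilde x$ is hyperbolic and $\tilde x_c(t)=\tilde x_d(t+\theta\tilde T)$ whenever $|t-t_0|<t^*$.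 For $\theta=0$ they are *locally rigidly synchronous*. **Strong hyperbolicity.** For a set $\mathcal R$ of representatives of a colouring $\bowtie$, let $[c]\in\mathcal R$ be the representative of $c$. The *induced equation* of $f$ is the equation $\dot u_r=f_r\big((u_{[c]})_{c\in\mathcal C}\big)$, $r\in\mathcal R$, on $\prod_{r\in\mathcal R}P_r$. The orbit $x$ is *strongly hyperbolic* if it is hyperbolic and, for each locally rigid synchrony pattern $\bowtie$ of $x$ at each $t_0$, there is an $\mathcal R$ such that for admissible $C^\infty$ maps $p$ with $\|p\|_1$ arbitrarily small, and $\tilde x$ arbitrarily close to $x$, the solution of the induced equation of $f+p$ that agrees with $(\tilde x_r(t))_{r\in\mathcal R}$ for $t$ near $t_0$ is a hyperbolic periodic orbit of that equation. **Corollary 10.4.** *The Local Rigid Input Property holds for all strongly hyperbolic periodic orbits.* That is, let $x$ be a strongly hyperbolic periodic orbit of $\dot x=f(x)$ with $f$ an admissible $C^\infty$ map. If $\bowtie$ is a locally rigid synchrony pattern of $x$ at some $t_0$, then $c\bowtie d$ implies that $c$ and $d$ are input isomorphic. If nodes $c,d$ are locally rigidly phase-related at some $t_0$ by some $\theta$ (in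 particular, if they are locally rigidly synchronous), then $c$ and $d$ are input isomorphic. -/

import Mathlib

open scoped ContDiff

noncomputable section

/-! ### Networks -/

/-- A network with finitely many nodes `C` and arrows `A`. Node-types and arrow-types are recorded
by the equivalence relations "same type"; every arrow has a head node and a tail node. -/
structure Network (C A : Type*) where
  nodeType : Setoid C
  arrowType : Setoid A
  head : A → C
  tail : A → C

namespace Network

variable {C A : Type*} (G : Network C A)

/-- The input set `I(c)`: all arrows with head `c` (multiple arrows and self-loops are allowed). -/
abbrev InputSet (c : C) : Type _ := {a : A // G.head a = c}

/-- `B(c,d)`: input isomorphisms, that is, arrow-type preserving bijections `I(c) → I(d)`, where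
`c` and `d` have the same node-type. -/
structure InputIso (c d : C) where
  toEquiv : G.InputSet c ≃ G.InputSet d
  node_eq : G.nodeType c d
  arrow_eq : ∀ a : G.InputSet c, G.arrowType (a : A) (toEquiv a : A)

/-- `c ∼_I d`: there is an input isomorphism from `I(c)` to `I(d)`. -/
def InputIsomorphic (c d : C) : Prop := Nonempty (G.InputIso c d)

end Network

/-! ### Node spaces and state spaces -/

/-- The node space `ℝⁿ` with its Euclidean norm. -/
abbrev NodeSpace (n : ℕ) : Type := EuclideanSpace ℝ (Fin n)

/-- The identification of `ℝᵐ` with `ℝⁿ` when `m = n`. -/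
def NodeSpace.transport {m n : ℕ} (h : m = n) (v : NodeSpace m) : NodeSpace n :=
  WithLp.toLp 2 fun i => v (Fin.cast h.symm i)

/-- Equality of states of two nodes: the node spaces coincide and the points are equal. -/
def SameState {m n : ℕ} (u : NodeSpace m) (v : NodeSpace n) : Prop :=
  ∃ h : m = n, NodeSpace.transport h u = v

/-- The total state space `P = ∏_c P_c` with `P_c = ℝ^{k c}`. Its norm is the maximum of the
Euclidean norms of the components. -/
abbrev StateSpace {C : Type*} (k : C → ℕ) : Type _ := ∀ c : C, NodeSpace (k c)

/-! ### Admissible maps -/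

/-- `f : P → P` is `G`-admissible. -/
structure Network.IsAdmissible {C A : Type*} (G : Network C A) (k : C → ℕ)
    (f : StateSpace k → StateSpace k) : Prop where
  /-- Node compatibility: the equalities between node spaces that input isomorphisms impose
  (equality being an equivalence relation, nodes that are related by a chain of such
  identifications then have equal node spaces as well). -/
  compatible : ∀ (c d : C) (β : G.InputIso c d),
    k c = k d ∧ ∀ a : G.InputSet c, k (G.tail a) = k (G.tail (β.toEquiv a))
  /-- Domain condition: `f_c(x) = f̂_c(x_c, x_{T(c)})`. Pullback condition:
  `f̂_d(z, w) = f̂_c(z, β^* w)` for every `β ∈ B(c,d)`; here `z' = z` and `w' = β^* w`, read in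
  `P_c` and `P_{T(c)}`. -/
  domain_pullback :
    ∃ fhat : ∀ c : C,
        NodeSpace (k c) → (∀ a : G.InputSet c, NodeSpace (k (G.tail a))) → NodeSpace (k c),
      (∀ (x : StateSpace k) (c : C), f x c = fhat c (x c) fun a => x (G.tail a)) ∧
      ∀ (c d : C) (β : G.InputIso c d)
        (z' : NodeSpace (k c)) (w' : ∀ a : G.InputSet c, NodeSpace (k (G.tail a)))
        (z : NodeSpace (k d)) (w : ∀ a : G.InputSet d, NodeSpace (k (G.tail a))),
        SameState z' z → (∀ a, SameState (w' a) (w (β.toEquiv a))) →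
          SameState (fhat c z' w') (fhat d z w)

/-- `‖p‖₁ < ε` for the `C¹` norm `‖p‖₁ = sup_x max (‖p x‖, ‖D p x‖)`. -/
def C1NormLT {E : Type*} [NormedAddCommGroup E] [NormedSpace ℝ E] (p : E → E) (ε : ℝ) : Prop :=
  ∃ η < ε, ∀ x, ‖p x‖ ≤ η ∧ ‖fderiv ℝ p x‖ ≤ η

/-- The perturbations that are allowed: admissible `C^∞` maps with `‖p‖₁ < ε`. -/
structure Network.IsPerturbation {C A : Type*} [Fintype C] (G : Network C A) (k : C → ℕ)
    (p : StateSpace k → StateSpace k) (ε : ℝ) : Prop where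
  admissible : G.IsAdmissible k p
  smooth : ContDiff ℝ ∞ p
  small : C1NormLT p ε

/-! ### Hyperbolic periodic orbits -/

section Orbits

variable {E : Type*} [NormedAddCommGroup E] [NormedSpace ℝ E]

/-- `x` is a non-constant solution of `ẋ = F(x)`, defined for all times, with period `T > 0`. -/
structure IsPeriodicSolution (F : E → E) (x : ℝ → E) (T : ℝ) : Prop where
  period_pos : 0 < T
  solution : ∀ t, HasDerivAt x (F (x t)) t
  periodic : ∀ t, x (t + T) = x t
  nonconstant : ∃ t, x t ≠ x 0

/-- `x` is a hyperbolic periodic orbit of `ẋ = F(x)`: for the fundamental solution `Φ` of the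
variational equation along `x`, the Floquet multipliers (the eigenvalues of `Φ T`) are off the
unit circle, except for a simple eigenvalue `1`. -/
structure IsHyperbolicPeriodic [FiniteDimensional ℝ E] (F : E → E) (x : ℝ → E) (T : ℝ) :
    Prop where
  periodicSolution : IsPeriodicSolution F x T
  multipliers : ∃ Φ : ℝ → E →L[ℝ] E,
    Φ 0 = ContinuousLinearMap.id ℝ E ∧
    (∀ t, HasDerivAt Φ ((fderiv ℝ F (x t)).comp (Φ t)) t) ∧
    ((Φ T).toLinearMap.charpoly.rootMultiplicity 1 = 1) ∧
    ∀ z : ℂ, ‖z‖ = 1 →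
      (((Φ T).toLinearMap.charpoly.map (algebraMap ℝ ℂ)).IsRoot z) → z = 1

/-- `ℓ` defines a Poincaré section `{z | ℓ (z - x t₀) = 0}` transverse to the orbit `x` of
`ẋ = F(x)` at `x t₀`. -/
def IsSection (F : E → E) (x : ℝ → E) (t₀ : ℝ) (ℓ : E →L[ℝ] ℝ) : Prop := ℓ (F (x t₀)) ≠ 0

/-- `y` is a periodic solution of the perturbed equation `ẏ = F(y) + p(y)` that is `δ`-close to the
`T`-periodic orbit `x`: its period `S` is `δ`-close to `T`, it is uniformly `δ`-close to `x` over
one period, and its phase is fixed by a Poincaré section at `x t₀`. For hyperbolic `x` and small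
`δ`, a sufficiently small `p` has exactly one such `y`. -/
structure IsPerturbedOrbit (F p : E → E) (x : ℝ → E) (T t₀ : ℝ) (ℓ : E →L[ℝ] ℝ) (δ : ℝ)
    (y : ℝ → E) (S : ℝ) : Prop where
  periodicSolution : IsPeriodicSolution (F + p) y S
  period_close : |S - T| < δ
  close : ∀ t ∈ Set.Icc t₀ (t₀ + T), ‖y t - x t‖ < δ
  phase : ℓ (y t₀ - x t₀) = 0

end Orbits

/-! ### Local rigidity -/

section Rigidity

variable {C A : Type*} [Fintype C]

/-- A property `Q t y S` of perturbed orbits `y` with period `S` at time `t` holds *locally rigidly*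
at `t₀`: for all sufficiently small admissible `p`, the perturbed orbit is hyperbolic, and it has
the property for all `t` with `|t - t₀| < t*`. -/
def Network.HoldsLocallyRigidly (G : Network C A) (k : C → ℕ) (f : StateSpace k → StateSpace k)
    (x : ℝ → StateSpace k) (T t₀ : ℝ) (Q : ℝ → (ℝ → StateSpace k) → ℝ → Prop) : Prop :=
  ∃ ε > 0, ∃ δ > 0, ∃ tstar > 0, ∃ ℓ : StateSpace k →L[ℝ] ℝ, IsSection f x t₀ ℓ ∧
    ∀ p, G.IsPerturbation k p ε → ∀ (y : ℝ → StateSpace k) (S : ℝ),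
      IsPerturbedOrbit f p x T t₀ ℓ δ y S →
        IsHyperbolicPeriodic (f + p) y S ∧ ∀ t, |t - t₀| < tstar → Q t y S

/-- The colouring `col` is a locally rigid synchrony pattern at `x t₀`: the pattern of equal node
states of the perturbed orbit is `col`, for all small `p` and all times near `t₀`. -/
def Network.IsLocallyRigidPattern (G : Network C A) (k : C → ℕ)
    (f : StateSpace k → StateSpace k) (x : ℝ → StateSpace k) (T t₀ : ℝ) (col : Setoid C) : Prop :=
  G.HoldsLocallyRigidly k f x T t₀ fun t y _ =>
    ∀ c d, SameState (y t c) (y t d) ↔ col c d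

/-- Nodes `c` and `d` are locally rigidly phase-related at `x t₀`, with phase shift the proportion
`θ` of the period; `θ = 0` means that they are locally rigidly synchronous. -/
def Network.LocallyRigidlyPhaseRelated (G : Network C A) (k : C → ℕ)
    (f : StateSpace k → StateSpace k) (x : ℝ → StateSpace k) (T t₀ θ : ℝ) (c d : C) : Prop :=
  G.HoldsLocallyRigidly k f x T t₀ fun t y S => SameState (y t c) (y (t + θ * S) d)

end Rigidity

/-! ### Induced equations and strong hyperbolicity -/

section Induced

variable {C A : Type*}

/-- A set `R` of representatives of a colouring, given by the map `c ↦ [c]` that sends every node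
to the representative of its colour; nodes of one colour have the same node space. -/
structure Representatives (k : C → ℕ) (col : Setoid C) where
  rep : C → C
  rep_rel : ∀ c, col (rep c) c
  rep_eq : ∀ c d, col c d → rep c = rep d
  dim_eq : ∀ c, k (rep c) = k c

namespace Representatives

variable {k : C → ℕ} {col : Setoid C} (R : Representatives k col)

/-- The representatives, which are the nodes of the quasi-quotient. -/
abbrev Node : Type _ := {r : C // R.rep r = r}

instance [Finite C] : Fintype R.Node := Fintype.ofFinite _

/-- `[c]` as a representative. -/
def toNode (c : C) : R.Node := ⟨R.rep c, R.rep_eq _ _ (R.rep_rel c)⟩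

/-- The state space `P^R = ∏_{r ∈ R} P_r`. -/
abbrev Space : Type _ := ∀ r : R.Node, NodeSpace (k r)

/-- The identification of `P^R` with the polydiagonal: `x_c = u_{[c]}`. -/
def lift (u : R.Space) : StateSpace k := fun c => NodeSpace.transport (R.dim_eq c) (u (R.toNode c))

/-- The vector field of the induced equation `u̇_r = f_r(u_r, u_{[T(r)]})`, `r ∈ R`. -/
def induced (f : StateSpace k → StateSpace k) : R.Space → R.Space := fun u r => f (R.lift u) r

end Representatives

variable [Fintype C]

/-- `x` is strongly hyperbolic for the colouring `col`, a synchrony pattern near `t₀`: `x` is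
hyperbolic, and there is a set `R` of representatives such that, after an arbitrarily small
admissible perturbation `p`, the orbit `u` of the induced equation that is induced by the perturbed
orbit `y` (`u_r = y_r` for `r ∈ R` and times near `t₀`) is a hyperbolic periodic orbit of the
induced equation. If `y` has the synchrony pattern at all times, then `u_r = y_r` at all times. -/
def Network.IsStronglyHyperbolicFor (G : Network C A) (k : C → ℕ)
    (f : StateSpace k → StateSpace k) (x : ℝ → StateSpace k) (T t₀ : ℝ) (col : Setoid C) : Prop :=
  IsHyperbolicPeriodic f x T ∧
  ∃ R : Representatives k col, ∃ ℓ : StateSpace k →L[ℝ] ℝ, IsSection f x t₀ ℓ ∧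
    ∀ η > 0, ∃ p, G.IsPerturbation k p η ∧
      ∃ (y : ℝ → StateSpace k) (S : ℝ), IsPerturbedOrbit f p x T t₀ ℓ η y S ∧
      ∃ (u : ℝ → R.Space) (S' : ℝ),
        (∀ᶠ t in nhds t₀, ∀ r : R.Node, u t r = y t r) ∧
        IsHyperbolicPeriodic (R.induced (f + p)) u S'

/-- `x` is strongly hyperbolic: it is hyperbolic, and strongly hyperbolic for every colouring that
is a locally rigid synchrony pattern of `x`. (For other colourings `x` induces no solution of the
induced equation.) -/
def Network.IsStronglyHyperbolic (G : Network C A) (k : C → ℕ)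
    (f : StateSpace k → StateSpace k) (x : ℝ → StateSpace k) (T : ℝ) : Prop :=
  IsHyperbolicPeriodic f x T ∧
  ∀ (t₀ : ℝ) (col : Setoid C), G.IsLocallyRigidPattern k f x T t₀ col →
    G.IsStronglyHyperbolicFor k f x T t₀ col

end Induced

end

/-! A colour coincidence is a phase relation with `θ = 0`, so it suffices to treat nodes `c`, `d`
whose states at phases `0` and `θ` agree near `t₀` for every orbit of an open family of perturbed
orbits (`Linked`, `IsRobustFamily`). Suppose that `c` and `d` are not input isomorphic. Admissible
maps can then be perturbed at `c` without any effect on the equation of `d`. The contradiction comes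
in two stages.

Analysis. A hyperbolic orbit `y` persists under `F + s • q`, and the displacement is at most `s`
times a constant of `y` times the integral of `‖q‖` along `y`; the `C¹` size of `q` restricts only
how small `s` must be (`IsHyperbolicPeriodic.exists_perturbed_orbit`). Differentiating the link
gives `F_c = F_d` along the orbits, also after perturbation. As `q` enters only at `c`, its
pointwise value there is bounded by its integral (`exists_pointwise_bound`). If the input state of
`c` moved, a pigeonhole choice among bumps with disjoint supports would give a `q` of size at least
one at some time but of tiny integral (`exists_concentrated_bumpField`). So the input state of `c`
is constant near `t₀` (`Linked.frozen`). A frozen node satisfies `F_c = 0`, and the same argument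
freezes its inputs (`Frozen.tail`).

Linear algebra. The frozen components at the two phases are closed under taking inputs. Choose an
orbit with a minimal set of coincidences among them, and let `W` be the space of vectors with these
coincidences. Small perturbations preserve the coincidences, by minimality. Linearizing `F + s • q =
0` on the frozen components therefore puts the values of every test field `q` into `L W`, where `L`
is the linearization of `F` (`cutoff_mem_map`). Fields without coupling realize all of `W`
(`exists_testField_cutoff_eq`), so `W ≤ L W`, and equality follows by dimension. Hence all test
fields take values in `W` and respect the coincidence of `c` and `d`; a bump field that is nonzero
at `c` and zero at `d` does not. -/

noncomputable section

open Set Filter Topology MeasureTheory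

/-! ### Linear differential equations and the bordered monodromy system -/

section LinearODE

variable {E : Type*} [NormedAddCommGroup E] [NormedSpace ℝ E]

lemma linearODE_unique {A : ℝ → E →L[ℝ] E} {K : ℝ} (hA : ∀ t, ‖A t‖ ≤ K) {u v : ℝ → E}
    (hu : ∀ t, HasDerivAt u (A t (u t)) t) (hv : ∀ t, HasDerivAt v (A t (v t)) t) {t₁ : ℝ}
    (h : u t₁ = v t₁) : u = v := by
  refine ODE_solution_unique_univ (v := fun t x => A t x) (s := fun _ => univ)
    (K := K.toNNReal) (fun t => ?_) (fun t => ⟨hu t, mem_univ _⟩) (fun t => ⟨hv t, mem_univ _⟩) h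
  refine LipschitzWith.lipschitzOnWith (LipschitzWith.of_dist_le_mul fun x z => ?_)
  rw [dist_eq_norm, dist_eq_norm, ← map_sub]
  exact (A t).le_of_opNorm_le ((hA t).trans (Real.le_coe_toNNReal K)) _

variable [FiniteDimensional ℝ E]

/-- A vector killed at time `t` gives a solution that vanishes at `t`, hence also at time `0` by
uniqueness. This gives injectivity, which suffices in finite dimension. -/
lemma isUnit_fundamentalSolution {A : ℝ → E →L[ℝ] E} {K : ℝ} (hA : ∀ t, ‖A t‖ ≤ K)
    {Φ : ℝ → E →L[ℝ] E} (h0 : Φ 0 = ContinuousLinearMap.id ℝ E)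
    (hΦ : ∀ t, HasDerivAt Φ ((A t).comp (Φ t)) t) (t : ℝ) : IsUnit (Φ t) := by
  have := FiniteDimensional.complete ℝ E
  rw [ContinuousLinearMap.isUnit_iff_bijective]
  have inj : Function.Injective (Φ t : E →ₗ[ℝ] E) := by
    rw [injective_iff_map_eq_zero]
    intro z hz
    have := linearODE_unique hA (u := fun s => Φ s z) (v := fun _ => 0) (t₁ := t)
      (fun s => by simpa using (hΦ s).clm_apply (hasDerivAt_const s z))
      (fun s => by simpa using hasDerivAt_const s (0 : E)) hz
    have := congrFun this 0
    simpa [h0] using this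
  exact ⟨inj, LinearMap.injective_iff_surjective.1 inj⟩

lemma continuous_inverse_fundamentalSolution {A : ℝ → E →L[ℝ] E} {K : ℝ} (hA : ∀ t, ‖A t‖ ≤ K)
    {Φ : ℝ → E →L[ℝ] E} (h0 : Φ 0 = ContinuousLinearMap.id ℝ E)
    (hΦ : ∀ t, HasDerivAt Φ ((A t).comp (Φ t)) t) :
    Continuous fun t => Ring.inverse (Φ t) := by
  have := FiniteDimensional.complete ℝ E
  rw [continuous_iff_continuousAt]
  intro t
  obtain ⟨u, hu⟩ := isUnit_fundamentalSolution hA h0 hΦ t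
  have h1 : ContinuousAt Ring.inverse (Φ t) := hu ▸ NormedRing.inverse_continuousAt u
  exact ContinuousAt.comp (f := Φ) h1 (hΦ t).continuousAt

lemma hasDerivAt_variation_of_constants {A : ℝ → E →L[ℝ] E} {K : ℝ} (hA : ∀ t, ‖A t‖ ≤ K)
    {Φ : ℝ → E →L[ℝ] E} (h0 : Φ 0 = ContinuousLinearMap.id ℝ E)
    (hΦ : ∀ t, HasDerivAt Φ ((A t).comp (Φ t)) t) {b : ℝ → E} (hb : Continuous b) (z : E) (t : ℝ) :
    HasDerivAt (fun r => Φ r (z + ∫ s in (0 : ℝ)..r, Ring.inverse (Φ s) (b s)))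
      (A t (Φ t (z + ∫ s in (0 : ℝ)..t, Ring.inverse (Φ s) (b s))) + b t) t := by
  have := FiniteDimensional.complete ℝ E
  have hc : Continuous fun s => Ring.inverse (Φ s) (b s) :=
    (continuous_inverse_fundamentalSolution hA h0 hΦ).clm_apply hb
  have h1 := (hΦ t).clm_apply ((hc.integral_hasStrictDerivAt 0 t).hasDerivAt.const_add z)
  convert h1 using 1
  have h2 : Φ t (Ring.inverse (Φ t) (b t)) = b t := by
    have := Ring.mul_inverse_cancel _ (isUnit_fundamentalSolution hA h0 hΦ t)
    exact congrArg (fun L : E →L[ℝ] E => L (b t)) this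
  simp [h2]

/-- Simplicity of the eigenvalue `1` makes the bordered system of a periodic orbit solvable. -/
lemma exists_bordered_solution {M : E →L[ℝ] E}
    (hM : (M : E →ₗ[ℝ] E).charpoly.rootMultiplicity 1 = 1)
    {e : E} (he : e ≠ 0) (hMe : M e = e) (ℓ : E →L[ℝ] ℝ) (hℓ : ℓ e ≠ 0) (b : ℝ) (r : E) (m : ℝ) :
    ∃ (z : E) (σ : ℝ), z - M z - σ • e = r ∧ ℓ z + σ * b = m := by
  let T : (E × ℝ) →ₗ[ℝ] (E × ℝ) :=
    { toFun := fun p => (p.1 - M p.1 - p.2 • e, ℓ p.1 + p.2 * b)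
      map_add' := fun p q => by
        ext <;> simp <;> [skip; ring]
        module
      map_smul' := fun c p => by
        ext <;> simp <;> [skip; ring]
        module }
  have hinj : Function.Injective T := by
    rw [injective_iff_map_eq_zero]
    rintro ⟨z, σ⟩ hz
    have h1 : z - M z - σ • e = 0 := congrArg Prod.fst hz
    have h2 : ℓ z + σ * b = 0 := congrArg Prod.snd hz
    have h1' : M z - z = -(σ • e) := by rw [← sub_eq_zero, ← neg_eq_zero, ← h1]; abel
    have fr : Module.finrank ℝ (Module.End.maxGenEigenspace (M : E →ₗ[ℝ] E) 1) = 1 := by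
      rw [LinearMap.finrank_maxGenEigenspace_eq, hM]
    have e_mem : e ∈ Module.End.maxGenEigenspace (M : E →ₗ[ℝ] E) 1 := by
      rw [Module.End.mem_maxGenEigenspace]
      exact ⟨1, by simp [hMe]⟩
    have z_mem : z ∈ Module.End.maxGenEigenspace (M : E →ₗ[ℝ] E) 1 := by
      rw [Module.End.mem_maxGenEigenspace]
      -- `(M - 1) z` is a multiple of the fixed vector `e`, so `(M - 1)² z = 0`. Algebraic
      -- simplicity, not only geometric, then forces `z` onto the line of `e`.
      refine ⟨2, ?_⟩
      simp [pow_two, h1', hMe]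
    obtain ⟨c, hc⟩ := exists_smul_eq_of_finrank_eq_one fr
      (x := ⟨e, e_mem⟩) (by simpa [Subtype.ext_iff] using he) ⟨z, z_mem⟩
    have hc' : c • e = z := congrArg Subtype.val hc
    subst hc'
    have hσ : σ = 0 := by
      have : σ • e = 0 := by simpa [hMe] using h1
      simpa [he] using this
    subst hσ
    have : c = 0 := by simpa [hℓ] using h2
    simp [this]
  obtain ⟨⟨z, σ⟩, h⟩ := LinearMap.injective_iff_surjective.1 hinj (r, m)
  exact ⟨z, σ, congrArg Prod.fst h, congrArg Prod.snd h⟩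

end LinearODE

/-! ### Calculus on spaces of continuous curves -/

section Curves

variable {X : Type*} [TopologicalSpace X] [CompactSpace X]
  {E E' : Type*} [NormedAddCommGroup E] [NormedSpace ℝ E] [NormedAddCommGroup E'] [NormedSpace ℝ E']

/-- Pointwise application of a continuous family of operators to a continuous function. -/
def pointwiseCLM (a : C(X, E →L[ℝ] E')) : C(X, E) →L[ℝ] C(X, E') :=
  LinearMap.mkContinuous
    { toFun := fun h => ⟨fun t => a t (h t), a.continuous.clm_apply h.continuous⟩
      map_add' := fun h g => by ext; simp
      map_smul' := fun c h => by ext; simp } ‖a‖ fun h => by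
    rw [ContinuousMap.norm_le _ (by positivity)]
    intro t
    exact (a t).le_of_opNorm_le_of_le (a.norm_coe_le_norm t) (h.norm_coe_le_norm t)

@[simp] lemma pointwiseCLM_apply (a : C(X, E →L[ℝ] E')) (h : C(X, E)) (t : X) :
    pointwiseCLM a h t = a t (h t) := rfl

/-- Superposition with a `C¹` map is strictly differentiable on continuous functions. -/
lemma hasStrictFDerivAt_superposition {F : E → E'} (hF : ContDiff ℝ 1 F) (v₀ : C(X, E)) :
    HasStrictFDerivAt (fun v : C(X, E) => (⟨F, hF.continuous⟩ : C(E, E')).comp v)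
      (pointwiseCLM ((⟨fderiv ℝ F, hF.continuous_fderiv one_ne_zero⟩ : C(E, E →L[ℝ] E')).comp v₀))
      v₀ := by
  refine .of_isLittleO ?_
  rw [Asymptotics.isLittleO_iff]
  intro c hc
  -- On the compact range the derivative is continuous with one `δ` for all base points, so the mean
  -- value inequality holds uniformly in `t`.
  have hK : IsCompact (range v₀) := isCompact_range v₀.continuous
  have hu := hK.uniformContinuousAt_of_continuousAt (fderiv ℝ F)
    (fun z _ => (hF.continuous_fderiv one_ne_zero).continuousAt) (Metric.dist_mem_uniformity hc)
  obtain ⟨δ, hδ, hsub⟩ := Metric.mem_uniformity_dist.1 hu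
  have : Metric.ball v₀ δ ×ˢ Metric.ball v₀ δ ∈ 𝓝 (v₀, v₀) :=
    prod_mem_nhds (Metric.ball_mem_nhds _ hδ) (Metric.ball_mem_nhds _ hδ)
  filter_upwards [this]
  rintro ⟨v, w⟩ ⟨hv, hw⟩
  rw [ContinuousMap.norm_le _ (by positivity)]
  intro t
  have hv' : v t ∈ Metric.ball (v₀ t) δ := (v.dist_apply_le_dist t).trans_lt hv
  have hw' : w t ∈ Metric.ball (v₀ t) δ := (w.dist_apply_le_dist t).trans_lt hw
  have := (convex_ball (v₀ t) δ).norm_image_sub_le_of_norm_fderiv_le' (𝕜 := ℝ) (f := F)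
    (φ := fderiv ℝ F (v₀ t)) (C := c)
    (fun z _ => (hF.differentiable one_ne_zero).differentiableAt) (fun z hz => ?_) hw' hv'
  · refine this.trans ?_
    gcongr
    exact (v - w).norm_coe_le_norm t
  · have h1 := @hsub (v₀ t) z (by rw [dist_comm]; exact hz) ⟨t, rfl⟩
    rw [← dist_eq_norm, dist_comm]
    exact le_of_lt h1

/-- The primitive `t ↦ ∫₀ᵗ u` of a continuous curve on the unit interval. -/
def primitiveCLM [CompleteSpace E] : C(unitInterval, E) →L[ℝ] C(unitInterval, E) :=
  LinearMap.mkContinuous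
    { toFun := fun u => ⟨fun t => ∫ s in (0 : ℝ)..t, u (projIcc 0 1 zero_le_one s),
        (intervalIntegral.continuous_primitive (fun _ _ =>
          (u.continuous.comp continuous_projIcc).intervalIntegrable _ _) 0).comp
          continuous_subtype_val⟩
      map_add' := fun u v => by
        ext t
        simp only [ContinuousMap.coe_mk, ContinuousMap.add_apply]
        exact intervalIntegral.integral_add
          ((u.continuous.comp continuous_projIcc).intervalIntegrable _ _)
          ((v.continuous.comp continuous_projIcc).intervalIntegrable _ _)
      map_smul' := fun c u => by
        ext t
        simp } 1 fun u => by
    rw [ContinuousMap.norm_le _ (by positivity)]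
    intro t
    have := intervalIntegral.norm_integral_le_of_norm_le_const (a := 0) (b := (t : ℝ)) (C := ‖u‖)
      (f := fun s => u (projIcc 0 1 zero_le_one s)) (fun s _ => u.norm_coe_le_norm _)
    refine this.trans ?_
    rw [sub_zero, abs_of_nonneg t.2.1, one_mul]
    exact mul_le_of_le_one_right (norm_nonneg _) t.2.2

@[simp] lemma primitiveCLM_apply [CompleteSpace E] (u : C(unitInterval, E)) (t : unitInterval) :
    primitiveCLM u t = ∫ s in (0 : ℝ)..t, u (projIcc 0 1 zero_le_one s) := rfl

/-- A curve on the unit interval that solves the periodic integral equation extends to a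
`1`-periodic solution of the differential equation. -/
lemma exists_periodic_extension [CompleteSpace E] {H : E → E} (hH : Continuous H)
    (v : C(unitInterval, E))
    (hv : ∀ t, v t = v 1 + ∫ s in (0 : ℝ)..t, H (v (projIcc 0 1 zero_le_one s))) :
    ∃ V : ℝ → E, (∀ t, V (t + 1) = V t) ∧ (∀ t : unitInterval, V t = v t) ∧
      ∀ t, HasDerivAt V (H (V t)) t := by
  set w : ℝ → E := fun t => v (projIcc 0 1 zero_le_one t) with hw
  have hwc : Continuous w := v.continuous.comp continuous_projIcc
  have h01 : v 0 = v 1 := by simpa using hv 0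
  have hw0 : w 0 = v 0 := congrArg v (projIcc_left (h := zero_le_one))
  have hw1 : w 1 = v 1 := congrArg v (projIcc_right (h := zero_le_one))
  -- The curve is periodized before integrating; it closes up because the integral equation at `t =
  -- 0` reads `v 0 = v 1`. The integrand is then continuous on the whole line, and the primitive is
  -- differentiable at the integers too.
  set W : ℝ → E := w ∘ Int.fract with hW
  have hWc : Continuous W := hwc.continuousOn.comp_fract'' (by rw [hw0, hw1, h01])
  have hWper : Function.Periodic W 1 := fun t => by simp only [hW, Function.comp_apply, Int.fract_add_one]
  have hWI : ∀ t ∈ Icc (0 : ℝ) 1, W t = w t := by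
    intro t ht
    rcases eq_or_lt_of_le ht.2 with rfl | h
    · simp [hW, hw0, hw1, h01]
    · simp [hW, Int.fract_eq_self.2 ⟨ht.1, h⟩]
  set V : ℝ → E := fun t => v 1 + ∫ s in (0 : ℝ)..t, H (W s) with hV
  have hHW : Continuous fun s => H (W s) := hH.comp hWc
  have hVI : ∀ t ∈ Icc (0 : ℝ) 1, V t = w t := by
    intro t ht
    have h1 := hv ⟨t, ht⟩
    rw [hw]
    simp only [hV]
    rw [projIcc_of_mem zero_le_one ht, h1]
    congr 1
    refine intervalIntegral.integral_congr fun s hs => ?_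
    rw [uIcc_of_le ht.1] at hs
    rw [hWI s ⟨hs.1, hs.2.trans ht.2⟩]
  have hint : ∫ s in (0 : ℝ)..1, H (W s) = 0 := by
    have := hVI 1 (by simp)
    simpa [hV, hw1] using this
  have hVper : Function.Periodic V 1 := by
    intro t
    simp only [hV]
    rw [← intervalIntegral.integral_add_adjacent_intervals (b := t)
      (hHW.intervalIntegrable _ _) (hHW.intervalIntegrable _ _)]
    have : Function.Periodic (fun s => H (W s)) 1 := fun s => by simp only [hWper s]
    rw [this.intervalIntegral_add_eq t 0, zero_add, hint, add_zero]
  have hVW : ∀ t, V t = W t := by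
    intro t
    have h1 : V t = V (Int.fract t) := by
      have := hVper.sub_int_mul_eq (x := t) ⌊t⌋
      rw [← this, mul_one]; rfl
    rw [h1, hVI _ ⟨Int.fract_nonneg t, (Int.fract_lt_one t).le⟩]
    rfl
  refine ⟨V, hVper, fun t => ?_, fun t => ?_⟩
  · rw [hVI t t.2]; exact congrArg v (projIcc_val zero_le_one t)
  · rw [hVW]
    exact (hHW.integral_hasStrictDerivAt 0 t).hasDerivAt.const_add (v 1)

end Curves

/-- A quantitative surjectivity theorem. The distance to the new zero is controlled by the residual
`s • R a` alone. The Lipschitz constant `L` only affects the range of `s`, and `C` does not depend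
on `R`; this uniformity is what allows concentrated perturbations later. -/
lemma exists_zero_of_small_perturbation {X Y : Type*} [NormedAddCommGroup X] [NormedSpace ℝ X]
    [CompleteSpace X] [NormedAddCommGroup Y] [NormedSpace ℝ Y] [CompleteSpace Y]
    {G : X → Y} {G' : X →L[ℝ] Y} {a : X} (hG : HasStrictFDerivAt G G' a)
    (hG' : Function.Surjective G') (hGa : G a = 0) :
    ∃ C : ℝ, 0 < C ∧ ∀ (R : X → Y) (L b : ℝ),
      (∀ x ∈ Metric.closedBall a 1, ∀ x' ∈ Metric.closedBall a 1, ‖R x - R x'‖ ≤ L * ‖x - x'‖) →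
      ‖R a‖ ≤ b → ∀ᶠ s in 𝓝[>] (0 : ℝ), ∃ x, ‖x - a‖ ≤ C * b * s ∧ G x + s • R x = 0 := by
  set g := G'.nonlinearRightInverseOfSurjective (LinearMap.range_eq_top.2 hG') with hg
  have hN : 0 < g.nnnorm := G'.nonlinearRightInverseOfSurjective_nnnorm_pos _
  -- Both `G` and `s • R` are allowed an error `c`. Together they use half of `g.nnnorm⁻¹`, so a
  -- ball of radius `2 * g.nnnorm * b * s` covers one of radius `b * s`.
  set c : NNReal := g.nnnorm⁻¹ / 4 with hc
  have hc0 : 0 < c := by positivity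
  obtain ⟨u, hu, hGu⟩ := hG.approximates_deriv_on_nhds (Or.inr hc0)
  obtain ⟨r, hr, hru⟩ := Metric.nhds_basis_closedBall.mem_iff.1 hu
  refine ⟨2 * g.nnnorm, by positivity, fun R L b hR hb => ?_⟩
  have hb0 : 0 ≤ b := (norm_nonneg _).trans hb
  have ev1 : ∀ᶠ s in 𝓝[>] (0 : ℝ), s * L < c := by
    have : Tendsto (fun s : ℝ => s * L) (𝓝[>] 0) (𝓝 (0 * L)) :=
      ((continuous_id.mul continuous_const).tendsto 0).mono_left nhdsWithin_le_nhds
    rw [zero_mul] at this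
    exact this.eventually_lt_const (by exact_mod_cast hc0)
  have ev2 : ∀ᶠ s in 𝓝[>] (0 : ℝ), 2 * g.nnnorm * b * s < min r 1 := by
    have : Tendsto (fun s : ℝ => 2 * g.nnnorm * b * s) (𝓝[>] 0) (𝓝 (2 * g.nnnorm * b * 0)) :=
      ((continuous_const.mul continuous_id).tendsto 0).mono_left nhdsWithin_le_nhds
    rw [mul_zero] at this
    exact this.eventually_lt_const (by positivity)
  filter_upwards [ev1, ev2, self_mem_nhdsWithin] with s h1 h2 (h3 : 0 < s)
  have happ : ApproximatesLinearOn (fun x => G x + s • R x) G'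
      (Metric.closedBall a (min r 1)) (c + c) := by
    intro x hx x' hx'
    have e1 := hGu x (hru (Metric.closedBall_subset_closedBall (min_le_left _ _) hx))
      x' (hru (Metric.closedBall_subset_closedBall (min_le_left _ _) hx'))
    have e2 := hR x (Metric.closedBall_subset_closedBall (min_le_right _ _) hx)
      x' (Metric.closedBall_subset_closedBall (min_le_right _ _) hx')
    calc ‖G x + s • R x - (G x' + s • R x') - G' (x - x')‖
        = ‖(G x - G x' - G' (x - x')) + s • (R x - R x')‖ := by
          congr 1; rw [smul_sub]; abel
      _ ≤ c * ‖x - x'‖ + s * (L * ‖x - x'‖) := by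
          refine (norm_add_le _ _).trans (add_le_add e1 ?_)
          rw [norm_smul, Real.norm_of_nonneg h3.le]
          gcongr
      _ ≤ c * ‖x - x'‖ + c * ‖x - x'‖ := by
          rw [← mul_assoc]; gcongr
      _ = ((c + c : NNReal) : ℝ) * ‖x - x'‖ := by push_cast; ring
  have hs := happ.surjOn_closedBall_of_nonlinearRightInverse g (ε := 2 * g.nnnorm * b * s)
    (b := a) (by positivity) (Metric.closedBall_subset_closedBall h2.le)
  have h0 : (0 : Y) ∈ Metric.closedBall (G a + s • R a)
      (((g.nnnorm : ℝ)⁻¹ - ((c + c : NNReal) : ℝ)) * (2 * g.nnnorm * b * s)) := by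
    rw [mem_closedBall_iff_norm, hGa, zero_add, zero_sub, norm_neg, norm_smul,
      Real.norm_of_nonneg h3.le]
    have hN' : (0 : ℝ) < g.nnnorm := by exact_mod_cast hN
    have : ((g.nnnorm : ℝ)⁻¹ - ((c + c : NNReal) : ℝ)) * (2 * g.nnnorm * b * s) = s * b := by
      rw [hc]; push_cast; field_simp; norm_num
    rw [this]; gcongr
  obtain ⟨x, hx, hx0⟩ := hs h0
  exact ⟨x, by simpa [dist_eq_norm] using hx, hx0⟩

/-! ### The linearized periodic boundary value problem -/

section PeriodicOrbits

variable {E : Type*} [NormedAddCommGroup E] [NormedSpace ℝ E]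

lemma IsPeriodicSolution.continuous {F : E → E} {y : ℝ → E} {S : ℝ}
    (hy : IsPeriodicSolution F y S) : Continuous y :=
  continuous_iff_continuousAt.2 fun t => (hy.solution t).continuousAt

lemma IsPeriodicSolution.isCompact_range {F : E → E} {y : ℝ → E} {S : ℝ}
    (hy : IsPeriodicSolution F y S) : IsCompact (range y) :=
  Function.Periodic.compact_of_continuous (c := S) hy.periodic hy.period_pos.ne' hy.continuous

lemma IsPeriodicSolution.exists_bound {F : E → E} {y : ℝ → E} {S : ℝ}
    (hy : IsPeriodicSolution F y S) {E' : Type*} [NormedAddCommGroup E'] {g : E → E'}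
    (hg : Continuous g) : ∃ K, ∀ t, ‖g (y t)‖ ≤ K := by
  obtain ⟨K, hK⟩ := hy.isCompact_range.exists_bound_of_continuousOn hg.continuousOn
  exact ⟨K, fun t => hK _ ⟨t, rfl⟩⟩

variable [FiniteDimensional ℝ E] [CompleteSpace E]

/-- The linearization of the periodic boundary value problem at a hyperbolic periodic orbit, with
a phase condition, is surjective. -/
lemma IsHyperbolicPeriodic.exists_linearized_solution {F : E → E} (hF : ContDiff ℝ 1 F)
    {y : ℝ → E} {S : ℝ} (hy : IsHyperbolicPeriodic F y S) (a : unitInterval) (ℓ : E →L[ℝ] ℝ)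
    (hℓ : ℓ (F (y (S * a))) ≠ 0) (v₀ : C(unitInterval, E)) (hv₀ : ∀ t, v₀ t = y (S * t))
    (g : C(unitInterval, E)) (m : ℝ) :
    ∃ (h : C(unitInterval, E)) (σ : ℝ),
      (∀ t, h t - h 1 - (S • primitiveCLM (pointwiseCLM
        ((⟨fderiv ℝ F, hF.continuous_fderiv one_ne_zero⟩ : C(E, E →L[ℝ] E)).comp v₀) h) t +
          σ • primitiveCLM ((⟨F, hF.continuous⟩ : C(E, E)).comp v₀) t) = g t) ∧
      ℓ (h a) = m := by
  obtain ⟨hp, Φ, hΦ0, hΦ, hM, -⟩ := hy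
  have hS := hp.period_pos
  have hS' := hS.ne'
  have hyc := hp.continuous
  obtain ⟨K, hK⟩ := hp.exists_bound (hF.continuous_fderiv one_ne_zero)
  set A : ℝ → E →L[ℝ] E := fun t => fderiv ℝ F (y t) with hA
  have hAc : Continuous A := (hF.continuous_fderiv one_ne_zero).comp hyc
  have hFy : ∀ t, HasDerivAt (fun t => F (y t)) (A t (F (y t))) t := fun t =>
    ((hF.differentiable one_ne_zero) (y t)).hasFDerivAt.comp_hasDerivAt t (hp.solution t)
  have hflow : ∀ t, Φ t (F (y 0)) = F (y t) := fun t =>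
    congrFun (linearODE_unique hK (u := fun s => Φ s (F (y 0))) (v := fun t => F (y t)) (t₁ := 0)
      (fun s => by simpa using (hΦ s).clm_apply (hasDerivAt_const s (F (y 0)))) hFy
      (by simp [hΦ0])) t
  have he : F (y 0) ≠ 0 := by
    intro h
    apply hℓ
    rw [← hflow, h]
    simp
  have hyS : y S = y 0 := by simpa using hp.periodic 0
  have hMe : Φ S (F (y 0)) = F (y 0) := by rw [hflow, hyS]
  set b : ℝ → E := fun r => A r (g (projIcc 0 1 zero_le_one (r / S))) with hb
  have hbc : Continuous b := hAc.clm_apply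
    (g.continuous.comp (continuous_projIcc.comp (continuous_id.div_const S)))
  set e : ℝ → E := fun r => ∫ s in (0 : ℝ)..r, Ring.inverse (Φ s) (b s) with he'
  -- With `h = g + κ`, the integral equation becomes `κ' = A κ + b + (σ / S) F(y)` with `κ 0 = z`.
  -- The equation at the left end requires `h 1 = z`; this and the phase condition are exactly the
  -- bordered system for `z` and `σ`.
  obtain ⟨z, σ, hz1, hz2⟩ := exists_bordered_solution hM he hMe (ℓ.comp (Φ (S * a)))
    (by simpa [hflow] using hℓ) (a * ℓ (F (y (S * a)))) (Φ S (e S) + g 1)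
    (m - ℓ (g a) - ℓ (Φ (S * a) (e (S * a))))
  -- The first term is variation of constants for `b`. The second answers to the change of period,
  -- since `F (y r)` solves the variational equation.
  set κ : ℝ → E := fun r => Φ r (z + e r) + (σ / S * r) • F (y r) with hκ
  have hκ' : ∀ r, HasDerivAt κ (A r (κ r) + b r + (σ / S) • F (y r)) r := by
    intro r
    have h1 := hasDerivAt_variation_of_constants hK hΦ0 hΦ hbc z r
    have h2 := ((hasDerivAt_id r).const_mul (σ / S)).smul (hFy r)
    refine (h1.add h2).congr_deriv ?_
    simp only [hκ, he', hA, map_add, map_smul, id, mul_one]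
    abel
  have hκc : Continuous κ := continuous_iff_continuousAt.2 fun r => (hκ' r).continuousAt
  have hκ0 : κ 0 = z := by simp [hκ, hΦ0, he']
  have hκS : κ S + g 1 = z := by
    have : κ S = Φ S z + Φ S (e S) + σ • F (y 0) := by
      simp only [hκ, map_add, hyS]
      rw [div_mul_cancel₀ _ hS']
    rw [this]
    have h3 : z = Φ S z + σ • F (y 0) + (Φ S (e S) + g 1) := by rw [← hz1]; abel
    conv_rhs => rw [h3]
    abel
  set h : C(unitInterval, E) := ⟨fun t => g t + κ (S * t), by fun_prop⟩ with hh
  have hht : ∀ t, h t = g t + κ (S * t) := fun t => rfl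
  have hh1 : h 1 = z := by rw [hht, ← hκS, add_comm]; simp
  refine ⟨h, σ, fun t => ?_, ?_⟩
  · have hder : ∀ r, HasDerivAt (fun r => κ (S * r))
        (S • (A (S * r) (κ (S * r)) + b (S * r) + (σ / S) • F (y (S * r)))) r := by
      intro r
      exact ((hκ' (S * r)).scomp r ((hasDerivAt_id r).const_mul S)).congr_deriv (by simp)
    have hcont : Continuous fun r =>
        S • (A (S * r) (κ (S * r)) + b (S * r) + (σ / S) • F (y (S * r))) := by
      have := hF.continuous
      fun_prop
    have hint := intervalIntegral.integral_eq_sub_of_hasDerivAt (a := 0) (b := (t : ℝ))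
      (fun r _ => hder r) (hcont.intervalIntegrable _ _)
    rw [mul_zero, hκ0] at hint
    have e1 : S • primitiveCLM (pointwiseCLM
        ((⟨fderiv ℝ F, hF.continuous_fderiv one_ne_zero⟩ : C(E, E →L[ℝ] E)).comp v₀) h) t +
          σ • primitiveCLM ((⟨F, hF.continuous⟩ : C(E, E)).comp v₀) t = κ (S * t) - z := by
      rw [← hint, primitiveCLM_apply, primitiveCLM_apply, ← intervalIntegral.integral_smul,
        ← intervalIntegral.integral_smul, ← intervalIntegral.integral_add]
      · refine intervalIntegral.integral_congr fun r hr => ?_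
        rw [uIcc_of_le t.2.1] at hr
        have hr' : r ∈ Icc (0 : ℝ) 1 := ⟨hr.1, hr.2.trans t.2.2⟩
        simp only [projIcc_of_mem zero_le_one hr', pointwiseCLM_apply, ContinuousMap.comp_apply,
          ContinuousMap.coe_mk, hv₀, hht, hb, mul_div_cancel_left₀ r hS', map_add, smul_add,
          smul_smul, mul_div_cancel₀ σ hS', hA]
        abel
      · exact (((pointwiseCLM _ h).continuous.comp continuous_projIcc).const_smul S
          ).intervalIntegrable _ _
      · exact (((ContinuousMap.comp _ v₀).continuous.comp continuous_projIcc).const_smul σ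
          ).intervalIntegrable _ _
    rw [e1, hht, hh1]
    abel
  · rw [hht]
    have h4 : κ (S * a) = Φ (S * a) z + Φ (S * a) (e (S * a)) + (σ * a) • F (y (S * a)) := by
      simp only [hκ, map_add]
      congr 2
      field_simp
    rw [h4]
    simp only [map_add, map_smul, smul_eq_mul]
    simp only [ContinuousLinearMap.comp_apply] at hz2
    linarith

end PeriodicOrbits

/-! ### Persistence of hyperbolic periodic orbits, with an integral bound -/

section Persistence

variable {E : Type*} [NormedAddCommGroup E] [NormedSpace ℝ E] [CompleteSpace E]

/-- The periodic boundary value problem `v' = τ F(v)` on the unit interval, as an integral equation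
for the curve `v` and the period `τ`, with the phase condition `ℓ (v a) = m`. -/
def periodicProblem {F : E → E} (hF : Continuous F) (a : unitInterval) (ℓ : E →L[ℝ] ℝ) (m : ℝ)
    (p : C(unitInterval, E) × ℝ) : C(unitInterval, E) × ℝ :=
  (p.1 - ContinuousMap.const _ (p.1 1) - p.2 • primitiveCLM ((⟨F, hF⟩ : C(E, E)).comp p.1),
    ℓ (p.1 a) - m)

/-- The derivative of `periodicProblem`. -/
def periodicProblemDeriv {F : E → E} (hF : ContDiff ℝ 1 F) (a : unitInterval) (ℓ : E →L[ℝ] ℝ)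
    (p : C(unitInterval, E) × ℝ) : (C(unitInterval, E) × ℝ) →L[ℝ] (C(unitInterval, E) × ℝ) :=
  let fst := ContinuousLinearMap.fst ℝ C(unitInterval, E) ℝ
  ContinuousLinearMap.prod
    (fst - ((ContinuousLinearMap.const ℝ unitInterval).comp
        (ContinuousMap.evalCLM (M := E) ℝ (1 : unitInterval))).comp fst -
      (p.2 • ((primitiveCLM.comp (pointwiseCLM
        ((⟨fderiv ℝ F, hF.continuous_fderiv one_ne_zero⟩ : C(E, E →L[ℝ] E)).comp p.1))).comp fst) +
        (ContinuousLinearMap.snd ℝ C(unitInterval, E) ℝ).smulRight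
          (primitiveCLM ((⟨F, hF.continuous⟩ : C(E, E)).comp p.1))))
    ((ℓ.comp (ContinuousMap.evalCLM ℝ a)).comp fst)

lemma hasStrictFDerivAt_periodicProblem {F : E → E} (hF : ContDiff ℝ 1 F) (a : unitInterval)
    (ℓ : E →L[ℝ] ℝ) (m : ℝ) (p : C(unitInterval, E) × ℝ) :
    HasStrictFDerivAt (periodicProblem hF.continuous a ℓ m) (periodicProblemDeriv hF a ℓ p) p := by
  have h1 : HasStrictFDerivAt (fun p : C(unitInterval, E) × ℝ => p.1)
    (ContinuousLinearMap.fst ℝ _ _) p := hasStrictFDerivAt_fst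
  have h2 : HasStrictFDerivAt (fun p : C(unitInterval, E) × ℝ => p.2)
    (ContinuousLinearMap.snd ℝ _ _) p := hasStrictFDerivAt_snd
  have h3 := ((ContinuousLinearMap.const ℝ unitInterval).comp
    (ContinuousMap.evalCLM (M := E) ℝ (1 : unitInterval))).hasStrictFDerivAt.comp p h1
  have h4 := (primitiveCLM.hasStrictFDerivAt.comp _
    (hasStrictFDerivAt_superposition hF p.1)).comp p h1
  have h5 := (ℓ.comp (ContinuousMap.evalCLM (M := E) ℝ a)).hasStrictFDerivAt.comp p h1
  exact ((h1.sub h3).sub (h2.smul h4)).prodMk (h5.sub_const m)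

lemma norm_primitiveCLM_apply_le (u : C(unitInterval, E)) : ‖primitiveCLM u‖ ≤ ‖u‖ := by
  rw [ContinuousMap.norm_le _ (by positivity)]
  intro t
  have := intervalIntegral.norm_integral_le_of_norm_le_const (a := 0) (b := (t : ℝ)) (C := ‖u‖)
    (f := fun s => u (projIcc 0 1 zero_le_one s)) (fun s _ => u.norm_coe_le_norm _)
  rw [sub_zero, abs_of_nonneg t.2.1] at this
  exact this.trans (mul_le_of_le_one_right (norm_nonneg _) t.2.2)

lemma norm_smul_primitiveCLM_sub_le {q : E → E} (hq : ContDiff ℝ 1 q) {M : ℝ}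
    (hM : ∀ x, ‖q x‖ ≤ M) (hM' : ∀ x, ‖fderiv ℝ q x‖ ≤ M) {S : ℝ} (hS : 0 < S)
    {v₀ : C(unitInterval, E)} {p p' : C(unitInterval, E) × ℝ}
    (hp : p ∈ Metric.closedBall (v₀, S) 1) :
    ‖p.2 • primitiveCLM ((⟨q, hq.continuous⟩ : C(E, E)).comp p.1) -
      p'.2 • primitiveCLM ((⟨q, hq.continuous⟩ : C(E, E)).comp p'.1)‖ ≤
      ((S + 1) * M + M) * ‖p - p'‖ := by
  have hM0 : 0 ≤ M := (norm_nonneg _).trans (hM 0)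
  set Q : C(E, E) := ⟨q, hq.continuous⟩ with hQ
  have hlip : ‖Q.comp p.1 - Q.comp p'.1‖ ≤ M * ‖p - p'‖ := by
    rw [ContinuousMap.norm_le _ (by positivity)]
    intro t
    have := convex_univ.norm_image_sub_le_of_norm_fderiv_le (𝕜 := ℝ) (f := q) (C := M)
      (fun z _ => (hq.differentiable one_ne_zero) z) (fun z _ => hM' z)
      (mem_univ (p'.1 t)) (mem_univ (p.1 t))
    refine this.trans ?_
    gcongr
    exact ((p.1 - p'.1).norm_coe_le_norm t).trans (norm_fst_le (p - p'))
  have hb : ‖Q.comp p'.1‖ ≤ M := by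
    rw [ContinuousMap.norm_le _ hM0]
    exact fun t => hM _
  have hp2 : |p.2| ≤ S + 1 := by
    rw [mem_closedBall_iff_norm] at hp
    have h1 : |p.2 - S| ≤ 1 := (norm_snd_le (p - (v₀, S))).trans hp
    rw [abs_le] at h1 ⊢
    constructor <;> linarith
  calc _ = ‖p.2 • primitiveCLM (Q.comp p.1 - Q.comp p'.1) +
        (p - p').2 • primitiveCLM (Q.comp p'.1)‖ := by
        rw [map_sub, Prod.snd_sub, sub_smul, smul_sub]; congr 1; abel
    _ ≤ (S + 1) * (M * ‖p - p'‖) + ‖p - p'‖ * M := by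
        refine (norm_add_le _ _).trans (add_le_add ?_ ?_)
        · rw [norm_smul, Real.norm_eq_abs]
          gcongr
          exact (norm_primitiveCLM_apply_le _).trans hlip
        · rw [norm_smul]
          gcongr
          · exact norm_snd_le (p - p')
          · exact (norm_primitiveCLM_apply_le _).trans hb
    _ = _ := by ring

/-- The left side is the residual of the unperturbed orbit in the perturbed problem, up to the
factor `s`. Integrating the equation is what replaces a supremum of `q` by its integral along the
orbit. -/
lemma norm_smul_primitiveCLM_le_integral {q : E → E} (hq : Continuous q) {y : ℝ → E}
    (hy : Continuous y) {S : ℝ} (hS : 0 < S) {v₀ : C(unitInterval, E)}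
    (hv₀ : ∀ t, v₀ t = y (S * t)) :
    ‖S • primitiveCLM ((⟨q, hq⟩ : C(E, E)).comp v₀)‖ ≤ ∫ t in (0 : ℝ)..S, ‖q (y t)‖ := by
  have hnn : 0 ≤ ∫ t in (0 : ℝ)..S, ‖q (y t)‖ :=
    intervalIntegral.integral_nonneg hS.le fun _ _ => norm_nonneg _
  rw [ContinuousMap.norm_le _ hnn]
  intro t
  have hc : Continuous fun r => ‖q (y (S * r))‖ := by fun_prop
  rw [ContinuousMap.smul_apply, primitiveCLM_apply, norm_smul, Real.norm_of_nonneg hS.le]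
  have h1 : ‖∫ s in (0 : ℝ)..t, ((⟨q, hq⟩ : C(E, E)).comp v₀) (projIcc 0 1 zero_le_one s)‖ ≤
      ∫ s in (0 : ℝ)..1, ‖q (y (S * s))‖ := by
    calc _ = ‖∫ s in (0 : ℝ)..t, q (y (S * s))‖ := by
          congr 1
          refine intervalIntegral.integral_congr fun r hr => ?_
          rw [uIcc_of_le t.2.1] at hr
          simp [projIcc_of_mem zero_le_one ⟨hr.1, hr.2.trans t.2.2⟩, hv₀]
      _ ≤ ∫ s in (0 : ℝ)..t, ‖q (y (S * s))‖ :=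
          intervalIntegral.norm_integral_le_integral_norm t.2.1
      _ ≤ _ := by
          refine intervalIntegral.integral_mono_interval le_rfl t.2.1 t.2.2 ?_
            (hc.intervalIntegrable _ _)
          exact Eventually.of_forall fun _ => norm_nonneg _
  calc _ ≤ S * ∫ s in (0 : ℝ)..1, ‖q (y (S * s))‖ := by gcongr
    _ = _ := by
      have := intervalIntegral.smul_integral_comp_mul_left (a := 0) (b := 1)
        (fun t => ‖q (y t)‖) S
      simpa using this

variable [FiniteDimensional ℝ E]

/-- A hyperbolic periodic orbit `y` persists under the perturbations `s • q`; the perturbed orbit,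
with its phase fixed by the section `ℓ`, is `O(s)`-close to `y`, with a constant that is
proportional to the integral of `‖q‖` along the orbit. -/
theorem IsHyperbolicPeriodic.exists_perturbed_orbit {F : E → E} (hF : ContDiff ℝ 1 F)
    {y : ℝ → E} {S : ℝ} (hy : IsHyperbolicPeriodic F y S) (t₀ : ℝ) (ℓ : E →L[ℝ] ℝ)
    (hℓ : ℓ (F (y t₀)) ≠ 0) :
    ∃ C : ℝ, 0 < C ∧ ∀ (q : E → E), ContDiff ℝ 1 q →
      ∀ M, (∀ x, ‖q x‖ ≤ M) → (∀ x, ‖fderiv ℝ q x‖ ≤ M) →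
      ∀ B, ∫ t in (0 : ℝ)..S, ‖q (y t)‖ ≤ B → ∀ᶠ s in 𝓝[>] (0 : ℝ), ∃ (Y : ℝ → E) (τ : ℝ),
        IsPeriodicSolution (F + s • q) Y τ ∧ ℓ (Y t₀ - y t₀) = 0 ∧ |τ - S| ≤ C * B * s ∧
        ∀ θ t, ‖Y (t + θ * τ) - y (t + θ * S)‖ ≤ C * B * s * (1 + |t|) := by
  have hp := hy.periodicSolution
  have hS := hp.period_pos
  have hyc := hp.continuous
  have hyper : Function.Periodic y S := hp.periodic
  -- The section time `t₀`, reduced modulo the period and rescaled to the unit interval.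
  set a : unitInterval := ⟨Int.fract (t₀ / S), Int.fract_nonneg _, (Int.fract_lt_one _).le⟩ with ha
  have hyt : ∀ t, y (S * a + t - t₀) = y t := by
    intro t
    have : S * (a : ℝ) + t - t₀ = t - ⌊t₀ / S⌋ * S := by
      simp only [ha, Int.fract]; field_simp; ring
    rw [this, hyper.sub_int_mul_eq]
  have hya : y (S * a) = y t₀ := by simpa using hyt t₀
  set v₀ : C(unitInterval, E) := ⟨fun t => y (S * t), by fun_prop⟩ with hv₀
  have hv₀t : ∀ t, v₀ t = y (S * t) := fun t => rfl
  have hsurj : Function.Surjective (periodicProblemDeriv hF a ℓ (v₀, S)) := by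
    rintro ⟨g, m⟩
    obtain ⟨h, σ, h1, h2⟩ := hy.exists_linearized_solution hF a ℓ (by rwa [hya]) v₀ hv₀t g m
    refine ⟨(h, σ), Prod.ext ?_ h2⟩
    ext t
    exact h1 t
  have hzero : periodicProblem hF.continuous a ℓ (ℓ (y t₀)) (v₀, S) = 0 := by
    refine Prod.ext ?_ (by simp [periodicProblem, hv₀t, hya])
    ext t
    have hder : ∀ r, HasDerivAt (fun r => y (S * r)) (S • F (y (S * r))) r := fun r =>
      ((hp.solution (S * r)).scomp r ((hasDerivAt_id r).const_mul S)).congr_deriv (by simp)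
    have hint := intervalIntegral.integral_eq_sub_of_hasDerivAt (a := 0) (b := (t : ℝ))
      (fun r _ => hder r) ((by have := hF.continuous; fun_prop :
        Continuous fun r => S • F (y (S * r))).intervalIntegrable _ _)
    have h1 : S • ∫ s in (0 : ℝ)..t,
        ((⟨F, hF.continuous⟩ : C(E, E)).comp v₀) (projIcc 0 1 zero_le_one s) =
        y (S * t) - y 0 := by
      rw [← intervalIntegral.integral_smul]
      rw [mul_zero] at hint
      rw [← hint]
      refine intervalIntegral.integral_congr fun r hr => ?_
      rw [uIcc_of_le t.2.1] at hr
      simp [projIcc_of_mem zero_le_one ⟨hr.1, hr.2.trans t.2.2⟩, hv₀t]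
    have h2 : y S = y 0 := by simpa using hp.periodic 0
    change v₀ t - v₀ 1 - S • _ = 0
    rw [primitiveCLM_apply, h1, hv₀t, hv₀t]
    simp [h2]
  obtain ⟨C₁, hC₁, key⟩ := exists_zero_of_small_perturbation
    (hasStrictFDerivAt_periodicProblem hF a ℓ (ℓ (y t₀)) (v₀, S)) hsurj hzero
  obtain ⟨K, hK⟩ := hp.exists_bound hF.continuous
  have hK0 : 0 ≤ K := (norm_nonneg _).trans (hK 0)
  have hylip : ∀ r r', ‖y r - y r'‖ ≤ K * |r - r'| := fun r r' =>
    convex_univ.norm_image_sub_le_of_norm_hasDerivWithin_le (f := y) (f' := fun t => F (y t))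
      (C := K) (fun t _ => (hp.solution t).hasDerivWithinAt) (fun t _ => hK t)
      (mem_univ _) (mem_univ _)
  -- `C₁` measures the distance of rescaled curves and of periods. The other factor pays for the
  -- drift between the time scales `τ` and `S`: `K` is a Lipschitz constant of `y`, `2 / S` bounds
  -- `τ⁻¹`, and the drift is linear in `t - t₀`. Equal phases `θ` cost nothing.
  refine ⟨C₁ * (1 + 2 * K / S * (1 + |t₀|)), by positivity, fun q hq M hM hM' B hB => ?_⟩
  have hM0 : 0 ≤ M := (norm_nonneg _).trans (hM 0)
  have hB0 : 0 ≤ B := (intervalIntegral.integral_nonneg hS.le fun _ _ => norm_nonneg _).trans hB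
  have hev := key (fun p => (-(p.2 • primitiveCLM ((⟨q, hq.continuous⟩ : C(E, E)).comp p.1)), 0))
    ((S + 1) * M + M) B ?_ ?_
  rotate_left
  · intro p hp' p' _
    rw [Prod.mk_sub_mk, sub_zero, Prod.norm_mk, norm_zero, max_eq_left (norm_nonneg _),
      neg_sub_neg, norm_sub_rev]
    exact norm_smul_primitiveCLM_sub_le hq hM hM' hS hp'
  · rw [Prod.norm_mk, norm_zero, max_eq_left (norm_nonneg _), norm_neg]
    exact (norm_smul_primitiveCLM_le_integral hq.continuous hyc hS hv₀t).trans hB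
  obtain ⟨t₁, ht₁⟩ := hp.nonconstant
  have ht₁' : 0 < ‖y t₁ - y 0‖ := norm_pos_iff.2 (sub_ne_zero.2 ht₁)
  set C := C₁ * (1 + 2 * K / S * (1 + |t₀|)) with hC
  have small : ∀ c d : ℝ, 0 < d → ∀ᶠ s in 𝓝[>] (0 : ℝ), c * s < d := by
    intro c d hd
    have : Tendsto (fun s : ℝ => c * s) (𝓝[>] 0) (𝓝 (c * 0)) :=
      ((continuous_const.mul continuous_id).tendsto 0).mono_left nhdsWithin_le_nhds
    rw [mul_zero] at this
    exact this.eventually_lt_const hd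
  -- The first smallness condition keeps `τ ≥ S / 2`; the second keeps the new orbit's values at
  -- `t₁` and `0` apart, so that it is not constant.
  filter_upwards [hev, small (C₁ * B) (S / 2) (by positivity),
    small (C * B * (2 + |t₁|)) _ ht₁', self_mem_nhdsWithin] with s hs hs1 hs2 (hs0 : 0 < s)
  obtain ⟨⟨v, τ⟩, hvτ, heq⟩ := hs
  have hv : ‖v - v₀‖ ≤ C₁ * B * s := (norm_fst_le ((v, τ) - (v₀, S))).trans hvτ
  have hτ : |τ - S| ≤ C₁ * B * s := (norm_snd_le ((v, τ) - (v₀, S))).trans hvτ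
  have hτ2 : S / 2 ≤ τ := by
    have := (abs_le.1 hτ).1
    linarith
  have hτ0 : 0 < τ := by linarith
  have heq1 : ∀ t, v t = v 1 + ∫ r in (0 : ℝ)..t,
      (τ • (F + s • q)) (v (projIcc 0 1 zero_le_one r)) := by
    intro t
    have h1 : v t - v 1 - τ • (∫ r in (0 : ℝ)..t, F (v (projIcc 0 1 zero_le_one r))) +
        s • (-(τ • ∫ r in (0 : ℝ)..t, q (v (projIcc 0 1 zero_le_one r)))) = 0 :=
      congrArg (fun p : C(unitInterval, E) × ℝ => p.1 t) heq
    have h2 : ∫ r in (0 : ℝ)..t, (τ • (F + s • q)) (v (projIcc 0 1 zero_le_one r)) =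
        τ • (∫ r in (0 : ℝ)..t, F (v (projIcc 0 1 zero_le_one r))) +
        s • (τ • ∫ r in (0 : ℝ)..t, q (v (projIcc 0 1 zero_le_one r))) := by
      rw [← intervalIntegral.integral_smul, ← intervalIntegral.integral_smul,
        ← intervalIntegral.integral_smul, ← intervalIntegral.integral_add]
      · refine intervalIntegral.integral_congr fun r _ => ?_
        simp [smul_comm s τ]
      · exact ((hF.continuous.comp (v.continuous.comp continuous_projIcc)).const_smul τ
          ).intervalIntegrable _ _
      · exact (((hq.continuous.comp (v.continuous.comp continuous_projIcc)).const_smul τ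
          ).const_smul s).intervalIntegrable _ _
    rw [h2, ← sub_eq_zero, ← h1, smul_neg]
    abel
  have heq2 : ℓ (v a) = ℓ (y t₀) := by
    have h1 : ℓ (v a) - ℓ (y t₀) + s • (0 : ℝ) = 0 :=
      congrArg (fun p : C(unitInterval, E) × ℝ => p.2) heq
    simpa [sub_eq_zero] using h1
  have hHc : Continuous (τ • (F + s • q)) :=
    (hF.continuous.add (hq.continuous.const_smul s)).const_smul τ
  obtain ⟨V, hV1, hV2, hV3⟩ := exists_periodic_extension hHc v heq1
  have hV1' : Function.Periodic V 1 := hV1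
  have hVy : ∀ r, ‖V r - y (S * r)‖ ≤ C₁ * B * s := by
    intro r
    have h1 : V r = V (Int.fract r) := by
      rw [← hV1'.sub_int_mul_eq (x := r) ⌊r⌋, mul_one]; rfl
    have h2 : y (S * r) = y (S * Int.fract r) := by
      rw [← hyper.sub_int_mul_eq (x := S * r) ⌊r⌋]
      congr 1
      rw [Int.fract]; ring
    rw [h1, h2]
    set r' : unitInterval := ⟨Int.fract r, Int.fract_nonneg _, (Int.fract_lt_one _).le⟩
    have h3 : V (Int.fract r) = v r' := hV2 r'
    have h4 : y (S * Int.fract r) = v₀ r' := rfl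
    rw [h3, h4]
    exact ((v - v₀).norm_coe_le_norm r').trans hv
  have hbound : ∀ θ t, ‖V (a + (t + θ * τ - t₀) / τ) - y (t + θ * S)‖ ≤ C * B * s * (1 + |t|) := by
    intro θ t
    have h1 := hVy (a + (t + θ * τ - t₀) / τ)
    have h2 : y (t + θ * S) = y (S * (a + (t - t₀) / S + θ)) := by
      rw [← hyt]
      congr 1
      field_simp
      ring
    have h3 := hylip (S * (a + (t + θ * τ - t₀) / τ)) (S * (a + (t - t₀) / S + θ))
    have h4 : S * (a + (t + θ * τ - t₀) / τ) - S * (a + (t - t₀) / S + θ) =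
        (t - t₀) * (S - τ) / τ := by
      field_simp; ring
    have h5 : |(t - t₀) * (S - τ) / τ| ≤ (1 + |t|) * (1 + |t₀|) * (C₁ * B * s) * (2 / S) := by
      rw [abs_div, abs_mul, abs_of_pos hτ0, abs_sub_comm S τ]
      have e1 : |t - t₀| ≤ (1 + |t|) * (1 + |t₀|) := by
        have := abs_sub t t₀
        nlinarith [abs_nonneg t, abs_nonneg t₀]
      have e2 : τ⁻¹ ≤ 2 / S := by
        rw [← inv_div]
        exact inv_anti₀ (by positivity) hτ2
      rw [div_eq_mul_inv]
      gcongr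
    rw [h4] at h3
    rw [h2]
    calc _ ≤ C₁ * B * s + K * ((1 + |t|) * (1 + |t₀|) * (C₁ * B * s) * (2 / S)) := by
          refine (norm_sub_le_norm_sub_add_norm_sub _ _ _).trans (add_le_add h1 (h3.trans ?_))
          gcongr
      _ ≤ C₁ * B * s * (1 + |t|) + K * ((1 + |t|) * (1 + |t₀|) * (C₁ * B * s) * (2 / S)) := by
          have h6 : 0 ≤ C₁ * B * s * |t| := by positivity
          linarith
      _ = _ := by rw [hC]; ring
  have hbound0 : ∀ t, ‖V (a + (t - t₀) / τ) - y t‖ ≤ C * B * s * (1 + |t|) := fun t => by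
    simpa using hbound 0 t
  refine ⟨fun t => V (a + (t - t₀) / τ), τ, ⟨hτ0, fun t => ?_, fun t => ?_, t₁, fun h => ?_⟩,
    ?_, ?_, hbound⟩
  · have h1 : HasDerivAt (fun t : ℝ => (a : ℝ) + (t - t₀) / τ) (1 / τ) t :=
      (((hasDerivAt_id t).sub_const t₀).div_const τ).const_add _
    refine ((hV3 _).scomp t h1).congr_deriv ?_
    simp [smul_smul, hτ0.ne']
  · have h1 : (a : ℝ) + (t + τ - t₀) / τ = a + (t - t₀) / τ + 1 := by field_simp; ring
    simp only [h1, hV1]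
  · have h1 := hbound0 t₁
    have h2 := hbound0 0
    replace h : V (a + (t₁ - t₀) / τ) = V (a + (0 - t₀) / τ) := h
    rw [h] at h1
    have h3 : ‖y t₁ - y 0‖ ≤ C * B * s * (1 + |t₁|) + C * B * s * (1 + |(0 : ℝ)|) := by
      rw [norm_sub_rev] at h1
      exact (norm_sub_le_norm_sub_add_norm_sub _ _ _).trans (add_le_add h1 h2)
    rw [abs_zero] at h3
    linarith
  · rw [map_sub]
    simp [hV2, heq2]
  · refine hτ.trans ?_
    rw [hC, mul_assoc, mul_assoc]
    have h1 : 0 ≤ B * s := by positivity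
    have h2 : C₁ ≤ C₁ * (1 + 2 * K / S * (1 + |t₀|)) := by
      have : 0 ≤ C₁ * (2 * K / S * (1 + |t₀|)) := by positivity
      linarith
    exact mul_le_mul_of_nonneg_right h2 h1

end Persistence

/-! ### Smooth maps with bounded derivative, and interpolation -/

section Smooth

variable {E X Y E' : Type*} [NormedAddCommGroup E] [NormedSpace ℝ E] [NormedAddCommGroup X]
  [NormedSpace ℝ X] [NormedAddCommGroup Y] [NormedSpace ℝ Y] [NormedAddCommGroup E']
  [NormedSpace ℝ E']

/-- `q` and its derivative are bounded. -/
def IsC1Bounded (q : E → E') : Prop := ∃ M : ℝ, ∀ x, ‖q x‖ ≤ M ∧ ‖fderiv ℝ q x‖ ≤ M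

lemma isC1Bounded_comp {h : X → Y} (hh : ContDiff ℝ ∞ h) (hc : HasCompactSupport h)
    (T : Y →L[ℝ] E') (L : E →L[ℝ] X) : IsC1Bounded fun x => T (h (L x)) := by
  obtain ⟨M₁, hM₁⟩ := hc.exists_bound_of_continuous hh.continuous
  obtain ⟨M₂, hM₂⟩ := (hc.fderiv (𝕜 := ℝ)).exists_bound_of_continuous
    (hh.continuous_fderiv (by simp))
  refine ⟨max (‖T‖ * M₁) (‖T‖ * (M₂ * ‖L‖)), fun x => ⟨?_, ?_⟩⟩
  · exact (T.le_of_opNorm_le_of_le le_rfl (hM₁ _)).trans (le_max_left _ _)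
  · have h1 : HasFDerivAt (fun x => T (h (L x))) (T.comp ((fderiv ℝ h (L x)).comp L)) x :=
      T.hasFDerivAt.comp x
        ((hh.differentiable (by simp) (L x)).hasFDerivAt.comp x L.hasFDerivAt)
    rw [h1.fderiv]
    refine (ContinuousLinearMap.opNorm_comp_le _ _).trans (le_trans ?_ (le_max_right _ _))
    gcongr
    exact (ContinuousLinearMap.opNorm_comp_le _ _).trans (by gcongr; exact hM₂ _)

lemma IsC1Bounded.add {q q' : E → E'} (hq : IsC1Bounded q) (hq' : IsC1Bounded q')
    (hd : Differentiable ℝ q) (hd' : Differentiable ℝ q') :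
    IsC1Bounded fun x => q x + q' x := by
  obtain ⟨M, hM⟩ := hq
  obtain ⟨M', hM'⟩ := hq'
  refine ⟨M + M', fun x => ⟨norm_add_le_of_le (hM x).1 (hM' x).1, ?_⟩⟩
  rw [fderiv_fun_add (hd x) (hd' x)]
  exact norm_add_le_of_le (hM x).2 (hM' x).2

lemma contDiff_and_isC1Bounded_sum {ι : Type*} (s : Finset ι) {q : ι → E → E'}
    (hs : ∀ i, ContDiff ℝ ∞ (q i)) (hb : ∀ i, IsC1Bounded (q i)) :
    ContDiff ℝ ∞ (fun x => ∑ i ∈ s, q i x) ∧ IsC1Bounded fun x => ∑ i ∈ s, q i x := by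
  classical
  refine ⟨ContDiff.sum fun i _ => hs i, ?_⟩
  induction s using Finset.induction_on with
  | empty => exact ⟨0, fun x => by simp⟩
  | insert i s hi ih =>
    simp only [Finset.sum_insert hi]
    exact (hb i).add ih ((hs i).differentiable (by simp))
      ((ContDiff.sum fun i _ => hs i : ContDiff ℝ ∞ _).differentiable (by simp))

/-- Smooth interpolation at finitely many points. -/
lemma exists_contDiff_interpolation [FiniteDimensional ℝ X] (s : Finset X) (g : X → Y) :
    ∃ h : X → Y, ContDiff ℝ ∞ h ∧ HasCompactSupport h ∧ ∀ ζ ∈ s, h ζ = g ζ := by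
  classical
  induction s using Finset.induction_on with
  | empty => exact ⟨0, contDiff_const, HasCompactSupport.zero, by simp⟩
  | insert ζ s hζ ih =>
    obtain ⟨h, h1, h2, h3⟩ := ih
    -- The correcting bump is supported off the earlier points, so their values survive.
    have hn : ((s : Set X)ᶜ) ∈ 𝓝 ζ := s.finite_toSet.isClosed.isOpen_compl.mem_nhds (by simpa)
    obtain ⟨b, hb1, hb2, hb3, -, hb5⟩ := exists_contDiff_tsupport_subset (n := ⊤) hn
    refine ⟨fun z => h z + b z • (g ζ - h ζ), h1.add (hb3.smul contDiff_const),
      h2.add hb2.smul_right, fun z hz => ?_⟩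
    rcases Finset.mem_insert.1 hz with rfl | hz
    · simp [hb5]
    · have : b z = 0 := by
        by_contra hne
        exact hb1 (subset_tsupport _ hne) hz
      simp [this, h3 z hz]

end Smooth

/-! ### A common space for all node states -/

section Pad

variable {N : ℕ}

/-- The embedding of the node spaces into a common space. -/
def pad (N : ℕ) {n : ℕ} : NodeSpace n →L[ℝ] (Fin N → ℝ) :=
  LinearMap.toContinuousLinearMap
    { toFun := fun v i => if h : (i : ℕ) < n then v ⟨i, h⟩ else 0
      map_add' := fun u v => by ext i; simp only [Pi.add_apply]; split_ifs <;> simp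
      map_smul' := fun r v => by ext i; simp only [Pi.smul_apply]; split_ifs <;> simp }

/-- The projection of the common space onto the node spaces. -/
def unpad (N : ℕ) {n : ℕ} : (Fin N → ℝ) →L[ℝ] NodeSpace n :=
  LinearMap.toContinuousLinearMap
    { toFun := fun u => WithLp.toLp 2 fun i => if h : (i : ℕ) < N then u ⟨i, h⟩ else 0
      map_add' := fun u v => by ext i; simp only [PiLp.add_apply]; split_ifs <;> simp
      map_smul' := fun r v => by
        ext i; simp only [PiLp.smul_apply, RingHom.id_apply]; split_ifs <;> simp }

lemma pad_apply {n : ℕ} (v : NodeSpace n) (i : Fin N) :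
    pad N v i = if h : (i : ℕ) < n then v ⟨i, h⟩ else 0 := rfl

lemma unpad_apply {n : ℕ} (u : Fin N → ℝ) (i : Fin n) :
    unpad N u i = if h : (i : ℕ) < N then u ⟨i, h⟩ else 0 := rfl

lemma unpad_pad {n : ℕ} (h : n ≤ N) (v : NodeSpace n) : unpad N (pad N v) = v := by
  ext i
  simp [unpad_apply, pad_apply, i.2.trans_le h]

lemma pad_injective {n : ℕ} (h : n ≤ N) :
    Function.Injective (pad N : NodeSpace n →L[ℝ] (Fin N → ℝ)) :=
  Function.LeftInverse.injective (unpad_pad h)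

lemma SameState.pad_eq {m n : ℕ} {u : NodeSpace m} {v : NodeSpace n} (h : SameState u v) :
    pad N u = pad N v := by
  obtain ⟨rfl, rfl⟩ := h
  rfl

lemma sameState_unpad {m n : ℕ} (h : m = n) (u : Fin N → ℝ) :
    SameState (unpad N u : NodeSpace m) (unpad N u : NodeSpace n) := by
  subst h
  exact ⟨rfl, rfl⟩

lemma one_le_norm_pad_smul_unpad_one {n : ℕ} (hn : 1 ≤ n) (h : n ≤ N) {r : ℝ} (hr : 1 ≤ r) :
    1 ≤ ‖pad N (r • unpad N (fun _ => 1) : NodeSpace n)‖ := by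
  have h1 := norm_le_pi_norm (pad N (r • unpad N (fun _ => 1) : NodeSpace n)) ⟨0, hn.trans h⟩
  rw [pad_apply, dif_pos (show ((⟨0, hn.trans h⟩ : Fin N) : ℕ) < n from hn), PiLp.smul_apply,
    unpad_apply, dif_pos (show 0 < N from hn.trans h), smul_eq_mul, mul_one, Real.norm_eq_abs] at h1
  exact (hr.trans (le_abs_self r)).trans h1

end Pad

/-! ### Admissible test fields -/

namespace Network

section InputIso

variable {C A : Type*} (G : Network C A)

/-- The identity input isomorphism. -/
def InputIso.refl (c : C) : G.InputIso c c where
  toEquiv := Equiv.refl _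
  node_eq := G.nodeType.refl' c
  arrow_eq := fun a => G.arrowType.refl' a

variable {G}

/-- Composition with an input isomorphism. -/
def InputIso.trans {c d e : C} (β : G.InputIso c d) (γ : G.InputIso d e) : G.InputIso c e where
  toEquiv := β.toEquiv.trans γ.toEquiv
  node_eq := G.nodeType.trans' β.node_eq γ.node_eq
  arrow_eq := fun a => G.arrowType.trans' (β.arrow_eq a) (γ.arrow_eq (β.toEquiv a))

/-- The inverse input isomorphism. -/
def InputIso.symm {c d : C} (β : G.InputIso c d) : G.InputIso d c where
  toEquiv := β.toEquiv.symm
  node_eq := G.nodeType.symm' β.node_eq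
  arrow_eq := fun a => G.arrowType.symm' (by simpa using β.arrow_eq (β.toEquiv.symm a))

lemma InputIso.toEquiv_injective {c d : C} :
    Function.Injective (InputIso.toEquiv : G.InputIso c d → _) := by
  rintro ⟨β, _, _⟩ ⟨γ, _, _⟩ h
  cases h
  rfl

/-- Composition with a fixed input isomorphism, as an equivalence. -/
def InputIso.transEquiv (c : C) {d e : C} (γ : G.InputIso d e) :
    G.InputIso c d ≃ G.InputIso c e where
  toFun := fun β => β.trans γ
  invFun := fun β => β.trans γ.symm
  left_inv := fun β => InputIso.toEquiv_injective (by ext; simp [trans, symm])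
  right_inv := fun β => InputIso.toEquiv_injective (by ext; simp [trans, symm])

instance [Finite A] (c : C) : Fintype (G.InputSet c) := Fintype.ofFinite _

instance [Finite A] (c d : C) : Fintype (G.InputIso c d) :=
  have := Finite.of_injective _ (InputIso.toEquiv_injective (G := G) (c := c) (d := d))
  Fintype.ofFinite _

end InputIso

/-- The part of admissibility that does not depend on the map. -/
def Compatible {C A : Type*} (G : Network C A) (k : C → ℕ) : Prop :=
  ∀ (c d : C) (β : G.InputIso c d),
    k c = k d ∧ ∀ a : G.InputSet c, k (G.tail a) = k (G.tail (β.toEquiv a))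

section Admissible

variable {C A : Type*} {G : Network C A} {k : C → ℕ}

lemma IsAdmissible.eq_of_inputs_eq {f : StateSpace k → StateSpace k} (hf : G.IsAdmissible k f)
    {c : C} {x x' : StateSpace k} (hc : x c = x' c)
    (h : ∀ a : G.InputSet c, x (G.tail a) = x' (G.tail a)) : f x c = f x' c := by
  obtain ⟨fhat, hd, -⟩ := hf.domain_pullback
  rw [hd, hd, hc, funext h]

lemma sameState_add {m n : ℕ} {u u' : NodeSpace m} {v v' : NodeSpace n} (h : SameState u v)
    (h' : SameState u' v') : SameState (u + u') (v + v') := by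
  obtain ⟨rfl, rfl⟩ := h
  obtain ⟨_, rfl⟩ := h'
  exact ⟨rfl, rfl⟩

lemma sameState_smul {m n : ℕ} {u : NodeSpace m} {v : NodeSpace n} (r : ℝ) (h : SameState u v) :
    SameState (r • u) (r • v) := by
  obtain ⟨rfl, rfl⟩ := h
  exact ⟨rfl, rfl⟩

lemma IsAdmissible.add_smul {f g : StateSpace k → StateSpace k} (hf : G.IsAdmissible k f)
    (hg : G.IsAdmissible k g) (r : ℝ) : G.IsAdmissible k (f + r • g) := by
  refine ⟨hf.compatible, ?_⟩
  obtain ⟨fhat, hf1, hf2⟩ := hf.domain_pullback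
  obtain ⟨ghat, hg1, hg2⟩ := hg.domain_pullback
  refine ⟨fun c z w => fhat c z w + r • ghat c z w, fun x c => ?_, ?_⟩
  · simp [hf1, hg1]
  · intro c d β z' w' z w hz hw
    exact sameState_add (hf2 c d β z' w' z w hz hw) (sameState_smul r (hg2 c d β z' w' z w hz hw))

lemma isAdmissible_zero (h : G.Compatible k) : G.IsAdmissible k 0 :=
  ⟨h, fun _ _ _ => 0, fun _ _ => rfl, fun c d β _ _ _ _ _ _ =>
    ⟨(h c d β).1, by ext; simp [NodeSpace.transport]⟩⟩

end Admissible

section TestFields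

variable {C A : Type*} {G : Network C A} {k : C → ℕ}

section

variable [Fintype C]

/-- A smooth admissible map, bounded together with its derivative. -/
structure IsTestField (G : Network C A) (k : C → ℕ) (q : StateSpace k → StateSpace k) : Prop where
  admissible : G.IsAdmissible k q
  smooth : ContDiff ℝ ∞ q
  bounded : IsC1Bounded q

/-- Node states are interpolated by admissible maps without coupling. -/
lemma exists_testField_interpolation (hG : G.Compatible k) {N : ℕ}
    (s : Finset (Fin N → ℝ)) (g : (Fin N → ℝ) → (Fin N → ℝ)) :
    ∃ q, G.IsTestField k q ∧
      ∀ x e, pad N (x e) ∈ s → q x e = unpad N (g (pad N (x e))) := by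
  classical
  obtain ⟨h, h1, h2, h3⟩ := exists_contDiff_interpolation s g
  have hq : (fun x : StateSpace k => fun e => (unpad N (h (pad N (x e))) : NodeSpace (k e))) =
      fun x => ∑ e, ((ContinuousLinearMap.single ℝ (fun e => NodeSpace (k e)) e).comp (unpad N))
        (h (((pad N).comp (ContinuousLinearMap.proj (R := ℝ) (φ := fun e => NodeSpace (k e)) e)) x)) := by
    ext1 x
    simp only [ContinuousLinearMap.comp_apply, ContinuousLinearMap.single_apply,
      ContinuousLinearMap.proj_apply]
    exact (Finset.univ_sum_single (fun e => (unpad N (h (pad N (x e))) : NodeSpace (k e)))).symm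
  obtain ⟨hs, hb⟩ := contDiff_and_isC1Bounded_sum Finset.univ
    (q := fun e (x : StateSpace k) =>
      ((ContinuousLinearMap.single ℝ (fun e => NodeSpace (k e)) e).comp (unpad N))
        (h (((pad N).comp (ContinuousLinearMap.proj (R := ℝ) (φ := fun e => NodeSpace (k e)) e)) x)))
    (fun e => ContinuousLinearMap.contDiff _ |>.comp (h1.comp (ContinuousLinearMap.contDiff _)))
    (fun e => isC1Bounded_comp h1 h2 _ _)
  rw [← hq] at hs hb
  refine ⟨_, ⟨⟨hG, fun e z _ => unpad N (h (pad N z)), fun x e => rfl, ?_⟩, hs, hb⟩, ?_⟩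
  · intro c d β z' w' z w hz _
    simp only [hz.pad_eq (N := N)]
    exact sameState_unpad (hG c d β).1 _
  · intro x e he
    simp only [h3 _ he]

end

variable [Fintype A]

/-- The states of node `e` and its inputs, pulled back to `c` by an input isomorphism. -/
def pullState (N : ℕ) (k : C → ℕ) {c e : C} (β : G.InputIso c e) :
    StateSpace k →L[ℝ] (Fin N → ℝ) × (G.InputSet c → Fin N → ℝ) :=
  ((pad N).comp (ContinuousLinearMap.proj (R := ℝ) (φ := fun e => NodeSpace (k e)) e)).prod
    (ContinuousLinearMap.pi fun a =>
      (pad N).comp (ContinuousLinearMap.proj (G.tail (β.toEquiv a))))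

/-- The states of node `c` and its inputs. -/
abbrev inputState (N : ℕ) (k : C → ℕ) (G : Network C A) (c : C) :
    StateSpace k →L[ℝ] (Fin N → ℝ) × (G.InputSet c → Fin N → ℝ) :=
  pullState N k (InputIso.refl G c)

/-- The admissible map that is generated by a function `φ` on the input states of `c`. -/
def bumpField (N : ℕ) (k : C → ℕ) (G : Network C A) (c : C)
    (φ : (Fin N → ℝ) × (G.InputSet c → Fin N → ℝ) → ℝ) (x : StateSpace k) : StateSpace k :=
  fun e => (∑ β : G.InputIso c e, φ (pullState N k β x)) • unpad N fun _ => 1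

lemma bumpField_eq_zero {N : ℕ} {c e : C} (h : ¬ G.InputIsomorphic c e)
    (φ : (Fin N → ℝ) × (G.InputSet c → Fin N → ℝ) → ℝ) (x : StateSpace k) :
    bumpField N k G c φ x e = 0 := by
  have : IsEmpty (G.InputIso c e) := not_nonempty_iff.1 h
  simp [bumpField]

/-- The identity of `I(c)` already contributes `1`, and by nonnegativity of `φ` the other input
automorphisms cannot cancel it. -/
lemma one_le_norm_pad_bumpField {N : ℕ} (hk : ∀ c, 1 ≤ k c) (hN : ∀ c, k c ≤ N) {c : C}
    {φ : (Fin N → ℝ) × (G.InputSet c → Fin N → ℝ) → ℝ} (hφ : ∀ z, 0 ≤ φ z) {x : StateSpace k}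
    (hx : φ (inputState N k G c x) = 1) : 1 ≤ ‖pad N (bumpField N k G c φ x c)‖ := by
  have h1 : 1 ≤ ∑ β : G.InputIso c c, φ (pullState N k β x) := by
    rw [← hx]
    exact Finset.single_le_sum (f := fun β : G.InputIso c c => φ (pullState N k β x))
      (fun β _ => hφ _) (Finset.mem_univ (InputIso.refl G c))
  exact one_le_norm_pad_smul_unpad_one (hk c) (hN c) h1

variable [Fintype C]

lemma isTestField_bumpField (hG : G.Compatible k) {N : ℕ} {c : C}
    {φ : (Fin N → ℝ) × (G.InputSet c → Fin N → ℝ) → ℝ} (hφ : ContDiff ℝ ∞ φ)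
    (hφc : HasCompactSupport φ) : G.IsTestField k (bumpField N k G c φ) := by
  classical
  have hq : bumpField N k G c φ =
      fun x => ∑ p : (e : C) × G.InputIso c e,
        (((ContinuousLinearMap.single ℝ (fun e => NodeSpace (k e)) p.1).comp
          (ContinuousLinearMap.toSpanSingleton ℝ (unpad N fun _ => 1)))
            (φ (pullState N k p.2 x))) := by
    ext1 x
    rw [Fintype.sum_sigma]
    conv_lhs => rw [← Finset.univ_sum_single (bumpField N k G c φ x)]
    refine Finset.sum_congr rfl fun e _ => ?_
    simp only [ContinuousLinearMap.comp_apply, ContinuousLinearMap.single_apply,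
      ContinuousLinearMap.toSpanSingleton_apply, bumpField, Finset.sum_smul]
    exact map_sum (ContinuousLinearMap.single ℝ (fun e => NodeSpace (k e)) e) _ _
  obtain ⟨hs, hb⟩ := contDiff_and_isC1Bounded_sum Finset.univ
    (q := fun (p : (e : C) × G.InputIso c e) (x : StateSpace k) =>
      ((ContinuousLinearMap.single ℝ (fun e => NodeSpace (k e)) p.1).comp
          (ContinuousLinearMap.toSpanSingleton ℝ (unpad N fun _ => 1)))
            (φ (pullState N k p.2 x)))
    (fun e => ContinuousLinearMap.contDiff _ |>.comp (hφ.comp (ContinuousLinearMap.contDiff _)))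
    (fun e => isC1Bounded_comp hφ hφc _ _)
  rw [← hq] at hs hb
  refine ⟨⟨hG, fun e z w =>
    (∑ β : G.InputIso c e, φ (pad N z, fun a => pad N (w (β.toEquiv a)))) • unpad N fun _ => 1,
    fun x e => rfl, ?_⟩, hs, hb⟩
  intro d e γ z' w' z w hz hw
  -- The pullback condition holds because composing with `γ` permutes the summands: this is the
  -- reason for summing over all input isomorphisms from `c`.
  have hsum : ∑ β : G.InputIso c d, φ (pad N z', fun a => pad N (w' (β.toEquiv a))) =
      ∑ β : G.InputIso c e, φ (pad N z, fun a => pad N (w (β.toEquiv a))) := by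
    refine Fintype.sum_equiv (InputIso.transEquiv c γ) _ _ fun β => ?_
    rw [hz.pad_eq]
    congr 2
    ext1 a
    exact (hw (β.toEquiv a)).pad_eq
  simp only [hsum]
  exact sameState_smul _ (sameState_unpad (hG d e γ).1 _)

lemma norm_bumpField_le {N : ℕ} {c : C}
    {φ : (Fin N → ℝ) × (G.InputSet c → Fin N → ℝ) → ℝ} (hφ : ∀ z, 0 ≤ φ z) (x : StateSpace k) :
    ‖bumpField N k G c φ x‖ ≤ ∑ e, ∑ β : G.InputIso c e,
      φ (pullState N k β x) * ‖(unpad N (fun _ => 1) : NodeSpace (k e))‖ := by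
  have hnn : ∀ e, 0 ≤ ∑ β : G.InputIso c e,
      φ (pullState N k β x) * ‖(unpad N (fun _ => 1) : NodeSpace (k e))‖ := fun e =>
    Finset.sum_nonneg fun β _ => mul_nonneg (hφ _) (norm_nonneg _)
  rw [pi_norm_le_iff_of_nonneg (Finset.sum_nonneg fun e _ => hnn e)]
  intro e
  refine le_trans ?_ (Finset.single_le_sum (fun e _ => hnn e) (Finset.mem_univ e))
  rw [bumpField, norm_smul, ← Finset.sum_mul,
    Real.norm_of_nonneg (Finset.sum_nonneg fun β _ => hφ _)]

/-- If the input state of `c` takes infinitely many values along the times in `J`, then there are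
admissible maps that are concentrated near one of these values, in the sense of the integral along
a curve `y`. -/
lemma exists_concentrated_bumpField {N : ℕ} {c : C} {y z : ℝ → StateSpace k} (hy : Continuous y)
    {S : ℝ} (hS : 0 < S) {J : Set ℝ} (hJ : ((fun t => inputState N k G c (z t)) '' J).Infinite)
    {η : ℝ} (hη : 0 < η) :
    ∃ φ : (Fin N → ℝ) × (G.InputSet c → Fin N → ℝ) → ℝ, ContDiff ℝ ∞ φ ∧ HasCompactSupport φ ∧
      (∀ w, 0 ≤ φ w) ∧ (∃ t ∈ J, φ (inputState N k G c (z t)) = 1) ∧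
      ∫ t in (0 : ℝ)..S, ‖bumpField N k G c φ (y t)‖ ≤ η := by
  classical
  set M : ℝ := ∑ e, ∑ _β : G.InputIso c e, ‖(unpad N (fun _ => 1) : NodeSpace (k e))‖ with hM
  have hM0 : 0 ≤ M := Finset.sum_nonneg fun e _ => Finset.sum_nonneg fun β _ => norm_nonneg _
  -- Pigeonhole: `n` bumps with disjoint supports sum to at most `1`, so their integrals sum to at
  -- most `S * M < n * η`, and one of them is at most `η`.
  obtain ⟨n, hn⟩ := exists_nat_gt (S * M / η)
  have hn0 : (0 : ℝ) < n := lt_of_le_of_lt (by positivity) hn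
  obtain ⟨Z, hZ, hZn⟩ := hJ.exists_subset_card_eq n
  have hr : ∀ᶠ r in 𝓝[>] (0 : ℝ), ∀ p ∈ Z.offDiag, 2 * r < dist p.1 p.2 := by
    rw [Filter.eventually_all_finset]
    intro p hp
    have h1 : 0 < dist p.1 p.2 := dist_pos.2 (Finset.mem_offDiag.1 hp).2.2
    have : Tendsto (fun r : ℝ => 2 * r) (𝓝[>] 0) (𝓝 (2 * 0)) :=
      ((continuous_const.mul continuous_id).tendsto 0).mono_left nhdsWithin_le_nhds
    rw [mul_zero] at this
    exact this.eventually_lt_const h1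
  obtain ⟨r, hr, hr0⟩ := (hr.and self_mem_nhdsWithin).exists
  replace hr0 : 0 < r := hr0
  set b : ∀ ζ : (Fin N → ℝ) × (G.InputSet c → Fin N → ℝ), ContDiffBump ζ :=
    fun ζ => ⟨r / 2, r, by positivity, by linarith⟩ with hb
  have hsum : ∀ w, ∑ ζ ∈ Z, b ζ w ≤ 1 := by
    intro w
    by_cases hw : ∃ ζ ∈ Z, b ζ w ≠ 0
    · obtain ⟨ζ, hζ, hne⟩ := hw
      rw [Finset.sum_eq_single_of_mem ζ hζ]
      · exact (b ζ).le_one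
      · intro ζ' hζ' hne'
        by_contra h0
        have h1 : dist w ζ < r := by
          have : w ∈ Function.support (b ζ) := hne
          rwa [(b ζ).support_eq] at this
        have h2 : dist w ζ' < r := by
          have : w ∈ Function.support (b ζ') := h0
          rwa [(b ζ').support_eq] at this
        have h3 := hr (ζ', ζ) (Finset.mem_offDiag.2 ⟨hζ', hζ, hne'⟩)
        have h4 := dist_triangle_left ζ' ζ w
        simp only at h3
        linarith
    · push Not at hw
      rw [Finset.sum_eq_zero hw]
      exact zero_le_one
  have hcont : ∀ ζ, Continuous fun t => ‖bumpField N k G c (b ζ) (y t)‖ := by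
    intro ζ
    refine Continuous.norm (continuous_pi fun e => ?_)
    have h1 : Continuous fun t => ∑ β : G.InputIso c e, b ζ (pullState N k β (y t)) :=
      continuous_finsetSum _ fun β _ =>
        (b ζ).continuous.comp ((pullState N k β).continuous.comp hy)
    exact h1.smul continuous_const
  have htot : ∑ ζ ∈ Z, ∫ t in (0 : ℝ)..S, ‖bumpField N k G c (b ζ) (y t)‖ ≤ ∑ _ζ ∈ Z, η := by
    rw [← intervalIntegral.integral_finsetSum fun ζ _ => (hcont ζ).intervalIntegrable _ _]
    have h1 : ∀ t, ∑ ζ ∈ Z, ‖bumpField N k G c (b ζ) (y t)‖ ≤ M := by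
      intro t
      refine (Finset.sum_le_sum fun ζ _ => norm_bumpField_le (fun w => (b ζ).nonneg) (y t)).trans ?_
      rw [Finset.sum_comm]
      refine Finset.sum_le_sum fun e _ => ?_
      rw [Finset.sum_comm]
      refine Finset.sum_le_sum fun β _ => ?_
      rw [← Finset.sum_mul]
      exact mul_le_of_le_one_left (norm_nonneg _) (hsum _)
    have h2 : ∫ t in (0 : ℝ)..S, ∑ ζ ∈ Z, ‖bumpField N k G c (b ζ) (y t)‖ ≤
        ∫ _t in (0 : ℝ)..S, M :=
      intervalIntegral.integral_mono_on hS.le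
        ((continuous_finsetSum _ fun ζ _ => hcont ζ).intervalIntegrable _ _)
        (continuous_const.intervalIntegrable _ _) fun t _ => h1 t
    refine h2.trans ?_
    rw [intervalIntegral.integral_const, Finset.sum_const, hZn, sub_zero, smul_eq_mul,
      nsmul_eq_mul]
    rw [div_lt_iff₀ hη] at hn
    exact hn.le
  have hZne : Z.Nonempty := by
    rw [← Finset.card_pos, hZn]
    exact_mod_cast hn0
  obtain ⟨ζ, hζ, hle⟩ := Finset.exists_le_of_sum_le hZne htot
  obtain ⟨t, ht, rfl⟩ := hZ hζ
  exact ⟨b _, (b _).contDiff, (b _).hasCompactSupport, fun w => (b _).nonneg,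
    ⟨t, ht, (b _).one_of_mem_closedBall (by simp [(b _).rIn_pos.le])⟩, hle⟩

end TestFields

end Network

lemma ContDiff.exists_lipschitz_closedBall {E X : Type*} [NormedAddCommGroup E]
    [NormedSpace ℝ E] [ProperSpace E] [NormedAddCommGroup X]
    [NormedSpace ℝ X] {g : E → X} (hg : ContDiff ℝ 1 g) (R : ℝ) :
    ∃ L : ℝ, 0 ≤ L ∧ ∀ u v, ‖u‖ ≤ R → ‖v‖ ≤ R → ‖g u - g v‖ ≤ L * ‖u - v‖ := by
  obtain ⟨L, hL⟩ := (isCompact_closedBall (0 : E) R).exists_bound_of_continuousOn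
    (hg.continuous_fderiv one_ne_zero).continuousOn
  refine ⟨max L 0, le_max_right _ _, fun u v hu hv => ?_⟩
  exact (convex_closedBall (0 : E) R).norm_image_sub_le_of_norm_fderiv_le (𝕜 := ℝ)
    (fun z _ => hg.differentiable one_ne_zero z) (fun z hz => (hL z hz).trans (le_max_left _ _))
    (by simpa using hv) (by simpa using hu)

/-! ### Robust families: links freeze nodes, and frozen nodes freeze their inputs -/

namespace Network

variable {C A : Type*} {G : Network C A} {k : C → ℕ}

/-- The states of `c` at phase `θ₁` and of `d` at phase `θ₂` coincide near `t₀`, throughout the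
family. -/
def Linked (𝓕 : (StateSpace k → StateSpace k) → (ℝ → StateSpace k) → ℝ → Prop) (N : ℕ)
    (t₀ r : ℝ) (θ₁ θ₂ : ℝ) (c d : C) : Prop :=
  ∀ F y S, 𝓕 F y S → ∀ t, |t - t₀| < r → pad N (y (t + θ₁ * S) c) = pad N (y (t + θ₂ * S) d)

/-- The state of `c` at phase `θ` is constant near `t₀`, throughout the family. -/
def Frozen (𝓕 : (StateSpace k → StateSpace k) → (ℝ → StateSpace k) → ℝ → Prop)
    (t₀ r : ℝ) (θ : ℝ) (c : C) : Prop :=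
  ∀ F y S, 𝓕 F y S → ∀ t, |t - t₀| < r → y (t + θ * S) c = y (t₀ + θ * S) c

variable {𝓕 : (StateSpace k → StateSpace k) → (ℝ → StateSpace k) → ℝ → Prop}
  {N : ℕ} {t₀ r : ℝ}

lemma frozen_of_inputState_eq (hN : ∀ c, k c ≤ N) (hr : 0 < r) {θ : ℝ} {c : C}
    (h : ∀ F y S, 𝓕 F y S → ∀ t t', |t - t₀| < r → |t' - t₀| < r →
      inputState N k G c (y (t + θ * S)) = inputState N k G c (y (t' + θ * S))) :
    Frozen 𝓕 t₀ r θ c ∧ ∀ a : G.InputSet c, Frozen 𝓕 t₀ r θ (G.tail a) := by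
  have h0 : |t₀ - t₀| < r := by simpa
  refine ⟨fun F y S hy t ht => ?_, fun a F y S hy t ht => ?_⟩
  · exact pad_injective (hN c) (congrArg Prod.fst (h F y S hy t t₀ ht h0))
  · exact pad_injective (hN _) (congrFun (congrArg Prod.snd (h F y S hy t t₀ ht h0)) a)

variable [Fintype C]

/-- A family of periodic solutions `y`, with period `S`, of smooth admissible equations `ẏ = F(y)`,
which is open under perturbations of `F` by test fields, with control of the perturbed orbits. -/
structure IsRobustFamily (G : Network C A) (k : C → ℕ)
    (𝓕 : (StateSpace k → StateSpace k) → (ℝ → StateSpace k) → ℝ → Prop) : Prop where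
  admissible : ∀ {F y S}, 𝓕 F y S → G.IsAdmissible k F
  smooth : ∀ {F y S}, 𝓕 F y S → ContDiff ℝ ∞ F
  periodicSolution : ∀ {F y S}, 𝓕 F y S → IsPeriodicSolution F y S
  persistent : ∀ {F y S}, 𝓕 F y S → ∃ K : ℝ, 0 < K ∧ ∀ q, G.IsTestField k q →
    ∀ B, ∫ t in (0 : ℝ)..S, ‖q (y t)‖ ≤ B → ∀ᶠ s in 𝓝[>] (0 : ℝ), ∃ Y τ, 𝓕 (F + s • q) Y τ ∧
      ∀ θ t, ‖Y (t + θ * τ) - y (t + θ * S)‖ ≤ K * B * s * (1 + |t|)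

lemma IsRobustFamily.hasDerivAt_phase (h𝓕 : G.IsRobustFamily k 𝓕)
    {F : StateSpace k → StateSpace k} {y : ℝ → StateSpace k} {S : ℝ} (hy : 𝓕 F y S) (θ t : ℝ)
    (c : C) : HasDerivAt (fun t => y (t + θ * S) c) (F (y (t + θ * S)) c) t :=
  hasDerivAt_pi.1 (((h𝓕.periodicSolution hy).solution (t + θ * S)).comp_add_const t (θ * S)) c

lemma eventually_abs_sub_lt {t₀ r t : ℝ} (ht : |t - t₀| < r) : ∀ᶠ u in 𝓝 t, |u - t₀| < r :=
  (isOpen_lt (by fun_prop : Continuous fun u : ℝ => |u - t₀|) continuous_const).mem_nhds ht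

lemma Linked.vectorField_eq {θ₁ θ₂ : ℝ} {c d : C} (h : Linked 𝓕 N t₀ r θ₁ θ₂ c d)
    (h𝓕 : G.IsRobustFamily k 𝓕) {F : StateSpace k → StateSpace k} {y : ℝ → StateSpace k} {S : ℝ}
    (hy : 𝓕 F y S) {t : ℝ} (ht : |t - t₀| < r) :
    pad N (F (y (t + θ₁ * S)) c) = pad N (F (y (t + θ₂ * S)) d) := by
  have h1 := (pad N).hasFDerivAt.comp_hasDerivAt t (h𝓕.hasDerivAt_phase hy θ₁ t c)
  have h2 := (pad N).hasFDerivAt.comp_hasDerivAt t (h𝓕.hasDerivAt_phase hy θ₂ t d)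
  refine h1.unique (h2.congr_of_eventuallyEq ?_)
  filter_upwards [eventually_abs_sub_lt ht] with u hu
  exact h F y S hy u hu

lemma Frozen.vectorField_eq_zero {θ : ℝ} {c : C} (h : Frozen 𝓕 t₀ r θ c)
    (h𝓕 : G.IsRobustFamily k 𝓕) {F : StateSpace k → StateSpace k} {y : ℝ → StateSpace k} {S : ℝ}
    (hy : 𝓕 F y S) {t : ℝ} (ht : |t - t₀| < r) : F (y (t + θ * S)) c = 0 := by
  refine (h𝓕.hasDerivAt_phase hy θ t c).unique
    ((hasDerivAt_const t (y (t₀ + θ * S) c)).congr_of_eventuallyEq ?_)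
  filter_upwards [eventually_abs_sub_lt ht] with u hu
  exact h F y S hy u hu

lemma contDiff_pad_component {F : StateSpace k → StateSpace k} (hF : ContDiff ℝ ∞ F) (c : C) :
    ContDiff ℝ 1 fun x => pad N (F x c) :=
  (pad N).contDiff.comp ((contDiff_pi.1 (hF.of_le (by exact_mod_cast le_top))) c)

/-- A relation between the states of the perturbed orbits bounds the perturbation pointwise by its
integral along the orbit. -/
lemma IsRobustFamily.exists_pointwise_bound (h𝓕 : G.IsRobustFamily k 𝓕)
    {F : StateSpace k → StateSpace k} {y : ℝ → StateSpace k} {S : ℝ} (hy : 𝓕 F y S) {X : Type*}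
    [NormedAddCommGroup X] [NormedSpace ℝ X] {g₁ g₂ : StateSpace k → X} (hg₁ : ContDiff ℝ 1 g₁)
    (hg₂ : ContDiff ℝ 1 g₂) (θ₁ θ₂ : ℝ)
    (hbase : ∀ t, |t - t₀| < r → g₁ (y (t + θ₁ * S)) = g₂ (y (t + θ₂ * S))) :
    ∃ K : ℝ, 0 < K ∧ ∀ q, G.IsTestField k q → ∀ ρ : StateSpace k → X, Continuous ρ →
      (∀ (s : ℝ) Y τ, 𝓕 (F + s • q) Y τ → ∀ t, |t - t₀| < r →
        g₁ (Y (t + θ₁ * τ)) + s • ρ (Y (t + θ₁ * τ)) = g₂ (Y (t + θ₂ * τ))) →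
      ∀ t, |t - t₀| < r → ‖ρ (y (t + θ₁ * S))‖ ≤ K * ∫ t in (0 : ℝ)..S, ‖q (y t)‖ := by
  obtain ⟨K, hK, hpers⟩ := h𝓕.persistent hy
  have hp := h𝓕.periodicSolution hy
  obtain ⟨R, hR⟩ := hp.exists_bound continuous_id
  obtain ⟨L₁, hL₁, hl₁⟩ := hg₁.exists_lipschitz_closedBall (R + 1)
  obtain ⟨L₂, hL₂, hl₂⟩ := hg₂.exists_lipschitz_closedBall (R + 1)
  -- The constant is fixed before `q` is chosen. The summand `1` makes it positive, and `|t₀| + |r|`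
  -- bounds `|t|` on the window.
  refine ⟨(L₁ + L₂ + 1) * (K * (1 + (|t₀| + |r|))), by positivity, fun q hq ρ hρ hrel t ht => ?_⟩
  set B := ∫ t in (0 : ℝ)..S, ‖q (y t)‖ with hB
  have hB0 : 0 ≤ B := intervalIntegral.integral_nonneg hp.period_pos.le fun _ _ => norm_nonneg _
  by_contra! hlt
  -- A violation at `y` would persist at the nearby `Y`. There, subtracting the two relations and
  -- dividing by `s` bounds `ρ` by the Lipschitz constants times the displacement rate.
  have hopen : IsOpen {u | (L₁ + L₂ + 1) * (K * (1 + (|t₀| + |r|))) * B < ‖ρ u‖} :=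
    isOpen_lt continuous_const hρ.norm
  obtain ⟨e, he, hball⟩ := Metric.isOpen_iff.1 hopen _ hlt
  have hsmall : ∀ᶠ s in 𝓝[>] (0 : ℝ), K * B * s * (1 + |t|) < min e 1 := by
    have : Tendsto (fun s : ℝ => K * B * s * (1 + |t|)) (𝓝[>] 0) (𝓝 (K * B * 0 * (1 + |t|))) :=
      ((by fun_prop : Continuous fun s : ℝ => K * B * s * (1 + |t|)).tendsto 0).mono_left
        nhdsWithin_le_nhds
    rw [mul_zero, zero_mul] at this
    exact this.eventually_lt_const (by positivity)
  obtain ⟨s, ⟨⟨Y, τ, hY, hYy⟩, hs⟩, hs0⟩ :=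
    (((hpers q hq B le_rfl).and hsmall).and self_mem_nhdsWithin).exists
  replace hs0 : 0 < s := hs0
  have hb : ∀ θ, ‖y (t + θ * S)‖ ≤ R + 1 := fun θ => (hR _).trans (by linarith)
  have hb' : ∀ θ, ‖Y (t + θ * τ)‖ ≤ R + 1 := fun θ => by
    have h1 := norm_le_norm_add_norm_sub' (Y (t + θ * τ)) (y (t + θ * S))
    have h2 := hYy θ t
    have h3 := hR (t + θ * S)
    have h4 := min_le_right e 1
    simp only [id] at h3
    linarith
  have h1 : ‖s • ρ (Y (t + θ₁ * τ))‖ ≤ (L₁ + L₂) * (K * B * s * (1 + |t|)) := by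
    have e1 : s • ρ (Y (t + θ₁ * τ)) = (g₂ (Y (t + θ₂ * τ)) - g₂ (y (t + θ₂ * S))) -
        (g₁ (Y (t + θ₁ * τ)) - g₁ (y (t + θ₁ * S))) := by
      rw [← hrel s Y τ hY t ht, ← hbase t ht]; abel
    rw [e1]
    calc _ ≤ L₂ * (K * B * s * (1 + |t|)) + L₁ * (K * B * s * (1 + |t|)) := by
          refine (norm_sub_le _ _).trans (add_le_add ?_ ?_)
          · exact (hl₂ _ _ (hb' θ₂) (hb θ₂)).trans (by gcongr; exact hYy θ₂ t)
          · exact (hl₁ _ _ (hb' θ₁) (hb θ₁)).trans (by gcongr; exact hYy θ₁ t)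
      _ = _ := by ring
  have h2 : ‖ρ (Y (t + θ₁ * τ))‖ ≤ (L₁ + L₂) * (K * B * (1 + |t|)) := by
    rw [norm_smul, Real.norm_of_nonneg hs0.le] at h1
    refine le_of_mul_le_mul_left (h1.trans_eq ?_) hs0
    ring
  have h3 : Y (t + θ₁ * τ) ∈ Metric.ball (y (t + θ₁ * S)) e := by
    rw [mem_ball_iff_norm]
    exact (hYy θ₁ t).trans_lt (hs.trans_le (min_le_left _ _))
  have h4 := hball h3
  simp only [mem_ofPred_eq] at h4
  have h5 : |t| ≤ |t₀| + |r| := by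
    have := abs_sub_abs_le_abs_sub t t₀
    have := le_abs_self r
    linarith
  have h6 : (L₁ + L₂) * (K * B * (1 + |t|)) ≤ (L₁ + L₂ + 1) * (K * (1 + (|t₀| + |r|))) * B := by
    have : (L₁ + L₂) * (K * B * (1 + |t|)) ≤ (L₁ + L₂ + 1) * (K * B * (1 + (|t₀| + |r|))) := by
      have h7 : L₁ + L₂ ≤ L₁ + L₂ + 1 := by linarith
      have h8 : K * B * (1 + |t|) ≤ K * B * (1 + (|t₀| + |r|)) := by gcongr
      exact mul_le_mul h7 h8 (by positivity) (by positivity)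
    linarith
  linarith

variable [Fintype A]

/-- If a relation holds throughout the family that every perturbation at `c` has to enter, then
the input state of `c` is constant. -/
lemma IsRobustFamily.inputState_eq (h𝓕 : G.IsRobustFamily k 𝓕) (hk : ∀ c, 1 ≤ k c)
    (hN : ∀ c, k c ≤ N) {F : StateSpace k → StateSpace k} {y : ℝ → StateSpace k} {S : ℝ}
    (hy : 𝓕 F y S) {g₁ g₂ : StateSpace k → Fin N → ℝ} (hg₁ : ContDiff ℝ 1 g₁)
    (hg₂ : ContDiff ℝ 1 g₂) (θ₁ θ₂ : ℝ)
    (hbase : ∀ t, |t - t₀| < r → g₁ (y (t + θ₁ * S)) = g₂ (y (t + θ₂ * S))) (c : C)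
    (hrel : ∀ φ (s : ℝ) Y τ, 𝓕 (F + s • bumpField N k G c φ) Y τ → ∀ t, |t - t₀| < r →
      g₁ (Y (t + θ₁ * τ)) + s • pad N (bumpField N k G c φ (Y (t + θ₁ * τ)) c) =
        g₂ (Y (t + θ₂ * τ))) {t t' : ℝ} (ht : |t - t₀| < r) (ht' : |t' - t₀| < r) :
    inputState N k G c (y (t + θ₁ * S)) = inputState N k G c (y (t' + θ₁ * S)) := by
  have hp := h𝓕.periodicSolution hy
  have hc := hp.continuous
  have hG : G.Compatible k := (h𝓕.admissible hy).compatible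
  obtain ⟨K, hK, hbound⟩ := h𝓕.exists_pointwise_bound hy hg₁ hg₂ θ₁ θ₂ hbase
  by_contra hne
  have hconn : IsPreconnected (Metric.ball t₀ r) := (convex_ball t₀ r).isPreconnected
  have hball : ∀ t, t ∈ Metric.ball t₀ r ↔ |t - t₀| < r := fun t => by
    rw [Metric.mem_ball, Real.dist_eq]
  have hψ : Continuous fun t => inputState N k G c (y (t + θ₁ * S)) :=
    (inputState N k G c).continuous.comp (hc.comp (by fun_prop))
  -- A connected set with two points is infinite, so a moving input state leaves room for
  -- arbitrarily many disjoint bumps.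
  have hinf : ((fun t => inputState N k G c (y (t + θ₁ * S))) '' Metric.ball t₀ r).Infinite :=
    (hconn.image _ hψ.continuousOn).infinite_of_nontrivial
      ⟨_, ⟨t, (hball t).2 ht, rfl⟩, _, ⟨t', (hball t').2 ht', rfl⟩, hne⟩
  obtain ⟨φ, hφ, hφc, hφ0, ⟨u, hu, hφu⟩, hint⟩ := exists_concentrated_bumpField
    (z := fun t => y (t + θ₁ * S)) hc hp.period_pos hinf (η := 1 / (2 * K)) (by positivity)
  have hq : G.IsTestField k (bumpField N k G c φ) := isTestField_bumpField hG hφ hφc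
  have h1 := hbound _ hq (fun x => pad N (bumpField N k G c φ x c))
    ((pad N).continuous.comp ((continuous_apply c).comp hq.smooth.continuous))
    (hrel φ) u ((hball u).1 hu)
  have h2 := one_le_norm_pad_bumpField (G := G) hk hN hφ0 hφu
  have h3 : K * ∫ t in (0 : ℝ)..S, ‖bumpField N k G c φ (y t)‖ ≤ K * (1 / (2 * K)) := by gcongr
  have h4 : K * (1 / (2 * K)) = 1 / 2 := by field_simp
  linarith

/-- Bump fields generated at `c` vanish at `d`, so in the differentiated link they appear on one
side only. -/
lemma Linked.frozen {θ₁ θ₂ : ℝ} {c d : C} (h : Linked 𝓕 N t₀ r θ₁ θ₂ c d)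
    (h𝓕 : G.IsRobustFamily k 𝓕) (hk : ∀ c, 1 ≤ k c) (hN : ∀ c, k c ≤ N) (hr : 0 < r)
    (hcd : ¬ G.InputIsomorphic c d) : Frozen 𝓕 t₀ r θ₁ c := by
  refine (frozen_of_inputState_eq (G := G) hN hr fun F y S hy t t' ht ht' => ?_).1
  refine h𝓕.inputState_eq hk hN hy (contDiff_pad_component (h𝓕.smooth hy) c)
    (contDiff_pad_component (h𝓕.smooth hy) d) θ₁ θ₂
    (fun t ht => h.vectorField_eq h𝓕 hy ht) c (fun φ s Y τ hY t ht => ?_) ht ht'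
  have h1 := h.vectorField_eq h𝓕 hY ht
  simp only [Pi.add_apply, Pi.smul_apply, map_add, map_smul, bumpField_eq_zero hcd,
    smul_zero, add_zero] at h1
  exact h1

/-- The relation `F_c = 0` plays the role of the link: a bump at `c` cannot be compensated, so the
whole input state of `c` stands still. -/
lemma Frozen.tail {θ : ℝ} {c : C} (h : Frozen 𝓕 t₀ r θ c)
    (h𝓕 : G.IsRobustFamily k 𝓕) (hk : ∀ c, 1 ≤ k c) (hN : ∀ c, k c ≤ N) (hr : 0 < r)
    (a : G.InputSet c) : Frozen 𝓕 t₀ r θ (G.tail a) := by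
  refine (frozen_of_inputState_eq (G := G) hN hr fun F y S hy t t' ht ht' => ?_).2 a
  refine h𝓕.inputState_eq hk hN hy (contDiff_pad_component (h𝓕.smooth hy) c)
    (contDiff_const (c := 0)) θ θ
    (fun t ht => by rw [h.vectorField_eq_zero h𝓕 hy ht, map_zero]) c
    (fun φ s Y τ hY t ht => ?_) ht ht'
  have h1 := congrArg (pad N) (h.vectorField_eq_zero h𝓕 hY ht)
  simpa using h1

end Network

/-! ### Linear algebra on the frozen components -/

namespace Network

section Linear

variable {ι C : Type*} {k : C → ℕ}

open Classical in
/-- The projection that deletes the components outside `K`. -/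
def cutoff (k : C → ℕ) (K : ι → C → Prop) : (ι → StateSpace k) →ₗ[ℝ] (ι → StateSpace k) where
  toFun := fun u i e => if K i e then u i e else 0
  map_add' := fun u v => by
    funext i e
    simp only [Pi.add_apply]
    split_ifs <;> simp
  map_smul' := fun a u => by
    funext i e
    simp only [Pi.smul_apply, RingHom.id_apply]
    split_ifs <;> simp

lemma cutoff_of_mem {K : ι → C → Prop} {i : ι} {e : C} (h : K i e) (u : ι → StateSpace k) :
    cutoff k K u i e = u i e := if_pos h

lemma cutoff_of_notMem {K : ι → C → Prop} {i : ι} {e : C} (h : ¬ K i e) (u : ι → StateSpace k) :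
    cutoff k K u i e = 0 := if_neg h

/-- The pairs of components in `K` with equal states. -/
def coincidences (N : ℕ) (K : ι → C → Prop) (z : ι → StateSpace k) : Set ((ι × C) × (ι × C)) :=
  {p | K p.1.1 p.1.2 ∧ K p.2.1 p.2.2 ∧ pad N (z p.1.1 p.1.2) = pad N (z p.2.1 p.2.2)}

/-- The states supported on `K` that have all the coincidences of `z`. -/
def synchronySubspace (N : ℕ) (K : ι → C → Prop) (z : ι → StateSpace k) :
    Submodule ℝ (ι → StateSpace k) where
  carrier := {u | (∀ i e, ¬ K i e → u i e = 0) ∧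
    ∀ p ∈ coincidences N K z, pad N (u p.1.1 p.1.2) = pad N (u p.2.1 p.2.2)}
  add_mem' := fun {u v} hu hv => ⟨fun i e h => by simp [hu.1 i e h, hv.1 i e h],
    fun p hp => by simp [hu.2 p hp, hv.2 p hp]⟩
  zero_mem' := ⟨fun _ _ _ => rfl, fun p _ => by simp⟩
  smul_mem' := fun a u hu => ⟨fun i e h => by simp [hu.1 i e h], fun p hp => by simp [hu.2 p hp]⟩

end Linear

variable {C A : Type*} [Fintype C] {G : Network C A} {k : C → ℕ}

/-- The linearization of `F` at the states `z`, restricted to the components in `K`. -/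
def cutoffLinearization {ι : Type*} (F : StateSpace k → StateSpace k) (K : ι → C → Prop)
    (z : ι → StateSpace k) : (ι → StateSpace k) →ₗ[ℝ] (ι → StateSpace k) :=
  cutoff k K ∘ₗ LinearMap.pi fun i => (fderiv ℝ F (z i) : StateSpace k →ₗ[ℝ] StateSpace k) ∘ₗ
    LinearMap.proj i

/-- The derivative inherits the domain condition. Hence cutting off components outside a set closed
under inputs does not alter the linearization inside it. -/
lemma IsAdmissible.fderiv_apply_congr {F : StateSpace k → StateSpace k}
    (hF : G.IsAdmissible k F) (hFd : Differentiable ℝ F) (z : StateSpace k) {e : C}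
    {u v : StateSpace k} (he : u e = v e)
    (h : ∀ a : G.InputSet e, u (G.tail a) = v (G.tail a)) :
    fderiv ℝ F z u e = fderiv ℝ F z v e := by
  have hd : ∀ w : StateSpace k, HasDerivAt (fun s : ℝ => F (z + s • w) e) (fderiv ℝ F z w e) 0 := by
    intro w
    have h1 : HasDerivAt (fun s : ℝ => z + s • w) w 0 := by
      simpa using ((hasDerivAt_id (0 : ℝ)).smul_const w).const_add z
    have h2 : HasFDerivAt F (fderiv ℝ F z) (z + (0 : ℝ) • w) := by
      simpa using (hFd z).hasFDerivAt
    exact hasDerivAt_pi.1 (h2.comp_hasDerivAt 0 h1) e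
  have h3 : (fun s : ℝ => F (z + s • u) e) = fun s : ℝ => F (z + s • v) e := by
    funext s
    exact hF.eq_of_inputs_eq (by simp [he]) fun a => by simp [h a]
  exact (hd u).unique (h3 ▸ hd v)

variable {𝓕 : (StateSpace k → StateSpace k) → (ℝ → StateSpace k) → ℝ → Prop} {N : ℕ} {t₀ r : ℝ}
  {ι : Type*} [Fintype ι]

/-- Some member of the family has a minimal set of coincidences. -/
lemma exists_minimal_coincidences (hne : ∃ F y S, 𝓕 F y S) (N : ℕ) (t₀ : ℝ) (θ : ι → ℝ)
    (K : ι → C → Prop) : ∃ F y S, 𝓕 F y S ∧ ∀ F' Y τ, 𝓕 F' Y τ →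
      coincidences N K (fun i => Y (t₀ + θ i * τ)) ⊆ coincidences N K (fun i => y (t₀ + θ i * S)) →
      coincidences N K (fun i => Y (t₀ + θ i * τ)) =
        coincidences N K (fun i => y (t₀ + θ i * S)) := by
  classical
  have hex : ∃ n, ∃ F y S, 𝓕 F y S ∧
      (coincidences N K (fun i => y (t₀ + θ i * S))).ncard = n := by
    obtain ⟨F, y, S, h⟩ := hne
    exact ⟨_, F, y, S, h, rfl⟩
  obtain ⟨F, y, S, hy, hn⟩ := Nat.find_spec hex
  refine ⟨F, y, S, hy, fun F' Y τ hY hsub => eq_of_subset_of_ncard_le hsub ?_⟩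
  rw [hn]
  exact Nat.find_min' hex ⟨F', Y, τ, hY, rfl⟩

lemma eventually_coincidences_subset (K : ι → C → Prop) (z : ι → StateSpace k) :
    ∀ᶠ w in 𝓝 z, coincidences N K w ⊆ coincidences N K z := by
  have h : ∀ p : (ι × C) × (ι × C), ∀ᶠ w in 𝓝 z, p ∈ coincidences N K w →
      p ∈ coincidences N K z := by
    intro p
    by_cases hp : pad N (z p.1.1 p.1.2) = pad N (z p.2.1 p.2.2)
    · exact Eventually.of_forall fun w hw => ⟨hw.1, hw.2.1, hp⟩
    · have hc : ∀ x : ι × C, Continuous fun w : ι → StateSpace k => pad N (w x.1 x.2) :=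
        fun x => (pad N).continuous.comp ((continuous_apply x.2).comp (continuous_apply x.1))
      filter_upwards [(isOpen_ne_fun (hc p.1) (hc p.2)).mem_nhds hp] with w hw hw'
      exact absurd hw'.2.2 hw
  filter_upwards [Filter.eventually_all.2 h] with w hw p hp using hw p hp

/-- The values of a test field on frozen states lie in the image of the synchrony subspace under
the linearization. -/
lemma IsRobustFamily.cutoff_mem_map (h𝓕 : G.IsRobustFamily k 𝓕) (hr : 0 < r)
    {θ : ι → ℝ} {K : ι → C → Prop} (hK : ∀ i e, K i e → Frozen 𝓕 t₀ r (θ i) e)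
    (hKt : ∀ i e, K i e → ∀ a : G.InputSet e, K i (G.tail a))
    {F : StateSpace k → StateSpace k} {y : ℝ → StateSpace k} {S : ℝ} (hy : 𝓕 F y S)
    (hmin : ∀ F' Y τ, 𝓕 F' Y τ →
      coincidences N K (fun i => Y (t₀ + θ i * τ)) ⊆ coincidences N K (fun i => y (t₀ + θ i * S)) →
      coincidences N K (fun i => Y (t₀ + θ i * τ)) =
        coincidences N K (fun i => y (t₀ + θ i * S)))
    {q : StateSpace k → StateSpace k} (hq : G.IsTestField k q) :
    cutoff k K (fun i => q (y (t₀ + θ i * S))) ∈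
      (synchronySubspace N K fun i => y (t₀ + θ i * S)).map
        (cutoffLinearization F K fun i => y (t₀ + θ i * S)) := by
  have h0 : |t₀ - t₀| < r := by simpa
  set z : ι → StateSpace k := fun i => y (t₀ + θ i * S) with hz
  obtain ⟨M, hM, hpers⟩ := h𝓕.persistent hy
  have hF := h𝓕.smooth hy
  have hFd : Differentiable ℝ F := hF.differentiable (by simp)
  set B := ∫ t in (0 : ℝ)..S, ‖q (y t)‖ with hB
  have hB0 : 0 ≤ B := intervalIntegral.integral_nonneg (h𝓕.periodicSolution hy).period_pos.le
    fun _ _ => norm_nonneg _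
  -- The image is closed, so approximation suffices. No differentiable dependence of the perturbed
  -- orbit on `s` is needed, only its `O(s)` bound.
  rw [← SetLike.mem_coe, ← (Submodule.closed_of_finiteDimensional _).closure_eq,
    Metric.mem_closure_iff]
  intro η hη
  set D := M * B * (1 + |t₀|) with hD
  have hD0 : 0 ≤ D := by positivity
  have e1 : ∀ᶠ w in 𝓝 z, ∀ i, ‖F (w i) - F (z i) - fderiv ℝ F (z i) (w i - z i)‖ ≤
      η / (4 * (D + 1)) * ‖w i - z i‖ := by
    refine Filter.eventually_all.2 fun i => ?_
    have h1 := (hFd (z i)).hasFDerivAt.isLittleO.def (c := η / (4 * (D + 1))) (by positivity)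
    exact ((continuous_apply i).tendsto z).eventually h1
  have e2 : ∀ᶠ w in 𝓝 z, ∀ i, ‖q (w i) - q (z i)‖ ≤ η / 4 := by
    refine Filter.eventually_all.2 fun i => ?_
    have h1 : ∀ᶠ x in 𝓝 (z i), ‖q x - q (z i)‖ ≤ η / 4 := by
      have := Metric.tendsto_nhds.1 (hq.smooth.continuous.tendsto (z i)) (η / 4) (by positivity)
      filter_upwards [this] with x hx
      rw [← dist_eq_norm]; exact hx.le
    exact ((continuous_apply i).tendsto z).eventually h1
  obtain ⟨δ, hδ, hball⟩ := Metric.eventually_nhds_iff_ball.1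
    ((e1.and e2).and (eventually_coincidences_subset (N := N) K z))
  have hsmall : ∀ᶠ s in 𝓝[>] (0 : ℝ), D * s < δ := by
    have : Tendsto (fun s : ℝ => D * s) (𝓝[>] 0) (𝓝 (D * 0)) :=
      ((continuous_const.mul continuous_id).tendsto 0).mono_left nhdsWithin_le_nhds
    rw [mul_zero] at this
    exact this.eventually_lt_const hδ
  obtain ⟨s, ⟨⟨Y, τ, hY, hYy⟩, hs⟩, hs0⟩ :=
    (((hpers q hq B le_rfl).and hsmall).and self_mem_nhdsWithin).exists
  replace hs0 : 0 < s := hs0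
  set w : ι → StateSpace k := fun i => Y (t₀ + θ i * τ) with hw
  have hwz : ∀ i, ‖w i - z i‖ ≤ D * s := fun i => (hYy (θ i) t₀).trans_eq (by rw [hD]; ring)
  have hwball : w ∈ Metric.ball z δ := by
    rw [mem_ball_iff_norm]
    exact ((pi_norm_le_iff_of_nonneg (by positivity)).2 hwz).trans_lt hs
  obtain ⟨⟨hw1, hw2⟩, hw3⟩ := hball w hwball
  have hcoin := hmin _ _ _ hY hw3
  -- Frozen components satisfy `F (z i) = 0` and `F (w i) + s • q (w i) = 0`, so the linearization
  -- maps this difference quotient close to `q (w i)`, hence to `q (z i)`. It has the coincidences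
  -- of `z` because `w` has the same ones.
  set u : ι → StateSpace k := cutoff k K (s⁻¹ • (z - w)) with hu
  have huK : ∀ i e, K i e → u i e = s⁻¹ • (z i e - w i e) := fun i e h => cutoff_of_mem h _
  have hu_mem : u ∈ synchronySubspace N K z := by
    refine ⟨fun i e h => cutoff_of_notMem h _, fun p hp => ?_⟩
    have hp' : p ∈ coincidences N K w := by rw [hcoin]; exact hp
    rw [huK _ _ hp.1, huK _ _ hp.2.1, map_smul, map_smul, map_sub, map_sub, hp.2.2, hp'.2.2]
  refine ⟨_, ⟨u, hu_mem, rfl⟩, ?_⟩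
  rw [dist_eq_norm]
  refine lt_of_le_of_lt ?_ (half_lt_self hη)
  rw [pi_norm_le_iff_of_nonneg (by positivity)]
  intro i
  rw [pi_norm_le_iff_of_nonneg (by positivity)]
  intro e
  by_cases hie : K i e
  swap
  · have h1 : (cutoff k K (fun i => q (z i)) - cutoffLinearization F K z u) i e = 0 := by
      rw [Pi.sub_apply, Pi.sub_apply, cutoff_of_notMem hie, cutoffLinearization,
        LinearMap.comp_apply, cutoff_of_notMem hie, sub_zero]
    rw [h1, norm_zero]
    positivity
  have hlin : cutoffLinearization F K z u i e = s⁻¹ • fderiv ℝ F (z i) (z i - w i) e := by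
    rw [cutoffLinearization, LinearMap.comp_apply, cutoff_of_mem hie]
    have h1 : fderiv ℝ F (z i) (u i) e = fderiv ℝ F (z i) (s⁻¹ • (z i - w i)) e :=
      (h𝓕.admissible hy).fderiv_apply_congr hFd (z i) (huK i e hie)
        fun a => huK i _ (hKt i e hie a)
    rw [map_smul] at h1
    exact h1
  have hz0 : F (z i) e = 0 := (hK i e hie).vectorField_eq_zero h𝓕 hy h0
  have hw0 : F (w i) e + s • q (w i) e = 0 := (hK i e hie).vectorField_eq_zero h𝓕 hY h0
  have hdiff : (cutoff k K (fun i => q (z i)) - cutoffLinearization F K z u) i e =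
      (-(q (w i) - q (z i)) -
        s⁻¹ • (F (w i) - F (z i) - fderiv ℝ F (z i) (w i - z i))) e := by
    rw [Pi.sub_apply, Pi.sub_apply, cutoff_of_mem hie, hlin]
    have h1 : F (w i) e = -(s • q (w i) e) := eq_neg_of_add_eq_zero_left hw0
    simp only [Pi.sub_apply, Pi.neg_apply, Pi.smul_apply, hz0, h1, map_sub, smul_sub, smul_neg,
      smul_smul, inv_mul_cancel₀ hs0.ne', one_smul, smul_zero]
    abel
  rw [hdiff]
  refine (norm_le_pi_norm _ e).trans ((norm_sub_le _ _).trans ?_)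
  rw [norm_neg, norm_smul, Real.norm_of_nonneg (inv_nonneg.2 hs0.le)]
  have h2 : s⁻¹ * ‖F (w i) - F (z i) - fderiv ℝ F (z i) (w i - z i)‖ ≤ η / 4 := by
    calc _ ≤ s⁻¹ * (η / (4 * (D + 1)) * (D * s)) := by
          gcongr
          exact (hw1 i).trans (by gcongr; exact hwz i)
      _ = η / 4 * (D / (D + 1)) := by field_simp
      _ ≤ η / 4 * 1 := by
          gcongr
          rw [div_le_one (by positivity)]
          linarith
      _ = η / 4 := mul_one _
  have := hw2 i
  linarith

/-- Every vector in the synchrony subspace is the value of a test field. -/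
lemma exists_testField_cutoff_eq (hG : G.Compatible k) (hN : ∀ c, k c ≤ N) {K : ι → C → Prop}
    {z u : ι → StateSpace k} (hu : u ∈ synchronySubspace N K z) :
    ∃ q, G.IsTestField k q ∧ cutoff k K (fun i => q (z i)) = u := by
  classical
  -- The prescribed value depends only on the state `ζ`: components of `z` in `K` with the same
  -- state have the same `u`, by membership in the synchrony subspace.
  set g : (Fin N → ℝ) → (Fin N → ℝ) := fun ζ =>
    if h : ∃ p : ι × C, K p.1 p.2 ∧ pad N (z p.1 p.2) = ζ then
      pad N (u h.choose.1 h.choose.2) else 0 with hg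
  have hgz : ∀ i e, K i e → g (pad N (z i e)) = pad N (u i e) := by
    intro i e hie
    have h : ∃ p : ι × C, K p.1 p.2 ∧ pad N (z p.1 p.2) = pad N (z i e) := ⟨(i, e), hie, rfl⟩
    simp only [hg]
    rw [dif_pos h]
    exact hu.2 (h.choose, (i, e)) ⟨h.choose_spec.1, hie, h.choose_spec.2⟩
  obtain ⟨q, hq, hqv⟩ := exists_testField_interpolation hG
    (Finset.univ.image fun p : ι × C => pad N (z p.1 p.2)) g
  refine ⟨q, hq, ?_⟩
  funext i e
  by_cases hie : K i e
  · rw [cutoff_of_mem hie, hqv _ _ (Finset.mem_image.2 ⟨(i, e), Finset.mem_univ _, rfl⟩),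
      hgz i e hie, unpad_pad (hN e)]
  · rw [cutoff_of_notMem hie, hu.1 i e hie]

/-- Nodes that are linked throughout a robust family are input isomorphic. -/
theorem Linked.inputIsomorphic [Fintype A] {θ : ℝ} {c d : C} (h : Linked 𝓕 N t₀ r 0 θ c d)
    (h𝓕 : G.IsRobustFamily k 𝓕) (hne : ∃ F y S, 𝓕 F y S) (hk : ∀ c, 1 ≤ k c)
    (hN : ∀ c, k c ≤ N) (hr : 0 < r) : G.InputIsomorphic c d := by
  by_contra hcd
  have hdc : ¬ G.InputIsomorphic d c := fun ⟨β⟩ => hcd ⟨β.symm⟩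
  have h' : Linked 𝓕 N t₀ r θ 0 d c := fun F y S hy t ht => (h F y S hy t ht).symm
  -- Two copies of the network, `false` at phase `0` for `c` and `true` at phase `θ` for `d`, turn
  -- the phase relation into a coincidence.
  set Θ : Bool → ℝ := fun i => if i then θ else 0 with hΘ
  set K : Bool → C → Prop := fun i e => Frozen 𝓕 t₀ r (Θ i) e with hK
  have hc : K false c := h.frozen h𝓕 hk hN hr hcd
  have hd : K true d := h'.frozen h𝓕 hk hN hr hdc
  have hKt : ∀ i e, K i e → ∀ a : G.InputSet e, K i (G.tail a) :=
    fun i e hie a => Frozen.tail hie h𝓕 hk hN hr a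
  obtain ⟨F, y, S, hy, hmin⟩ := exists_minimal_coincidences hne N t₀ Θ K
  have hG : G.Compatible k := (h𝓕.admissible hy).compatible
  have hval := fun q (hq : G.IsTestField k q) =>
    h𝓕.cutoff_mem_map hr (fun i e hie => hie) hKt hy hmin hq
  set z : Bool → StateSpace k := fun i => y (t₀ + Θ i * S) with hz
  have hle : synchronySubspace N K z ≤
      (synchronySubspace N K z).map (cutoffLinearization F K z) := by
    intro u hu
    obtain ⟨q, hq, rfl⟩ := exists_testField_cutoff_eq hG hN hu
    exact hval q hq
  -- A linear image cannot have larger dimension, so `W ≤ L W` is an equality and every test field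
  -- takes values in `W`.
  have heq := Submodule.eq_of_le_of_finrank_le hle (Submodule.finrank_map_le _ _)
  let b : ContDiffBump (inputState N k G c (z false)) := default
  have hq : G.IsTestField k (bumpField N k G c b) :=
    isTestField_bumpField hG b.contDiff b.hasCompactSupport
  have hmem := hval _ hq
  rw [← heq] at hmem
  have hcoin : ((false, c), (true, d)) ∈ coincidences N K z :=
    ⟨hc, hd, h F y S hy t₀ (by simpa)⟩
  have h1 := hmem.2 _ hcoin
  simp only at h1
  rw [cutoff_of_mem hc, cutoff_of_mem hd, bumpField_eq_zero hcd, map_zero] at h1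
  have h2 := one_le_norm_pad_bumpField (G := G) hk hN (fun w => b.nonneg (x := w))
    (x := z false) (b.one_of_mem_closedBall (by simp [b.rIn_pos.le]))
  replace h1 : pad N (bumpField N k G c b (z false) c) = 0 := h1
  rw [h1, norm_zero] at h2
  linarith

end Network

/-! ### The orbits near a rigid periodic orbit form a robust family -/

namespace Network

variable {C A : Type*} [Fintype C] {G : Network C A} {k : C → ℕ}

/-- The perturbed orbits in the definition of local rigidity, as a family of periodic solutions of
the perturbed equations. -/
def nearbyOrbits (G : Network C A) (k : C → ℕ) (f : StateSpace k → StateSpace k)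
    (x : ℝ → StateSpace k) (T t₀ : ℝ) (ℓ : StateSpace k →L[ℝ] ℝ) (ε δ : ℝ)
    (F : StateSpace k → StateSpace k) (y : ℝ → StateSpace k) (S : ℝ) : Prop :=
  ∃ p, F = f + p ∧ G.IsPerturbation k p ε ∧ IsPerturbedOrbit f p x T t₀ ℓ δ y S

lemma IsPerturbation.mono {p : StateSpace k → StateSpace k} {ε ε' : ℝ}
    (hp : G.IsPerturbation k p ε) (h : ε ≤ ε') : G.IsPerturbation k p ε' :=
  ⟨hp.admissible, hp.smooth, let ⟨η, h1, h2⟩ := hp.small; ⟨η, h1.trans_le h, h2⟩⟩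

lemma _root_.IsPerturbedOrbit.mono {E : Type*} [NormedAddCommGroup E] [NormedSpace ℝ E]
    {F p : E → E} {x y : ℝ → E} {T t₀ S δ δ' : ℝ} {ℓ : E →L[ℝ] ℝ}
    (h : IsPerturbedOrbit F p x T t₀ ℓ δ y S) (hδ : δ ≤ δ') :
    IsPerturbedOrbit F p x T t₀ ℓ δ' y S :=
  ⟨h.periodicSolution, h.period_close.trans_le hδ, fun t ht => (h.close t ht).trans_le hδ, h.phase⟩

lemma IsPerturbation.eventually_add_smul {p q : StateSpace k → StateSpace k} {ε : ℝ}
    (hp : G.IsPerturbation k p ε) (hq : G.IsTestField k q) :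
    ∀ᶠ s in 𝓝[>] (0 : ℝ), G.IsPerturbation k (p + s • q) ε := by
  obtain ⟨η, hη, hpη⟩ := hp.small
  obtain ⟨M, hM⟩ := hq.bounded
  have h : ∀ᶠ s in 𝓝[>] (0 : ℝ), η + s * M < ε := by
    have : Tendsto (fun s : ℝ => η + s * M) (𝓝[>] 0) (𝓝 (η + 0 * M)) :=
      ((by fun_prop : Continuous fun s : ℝ => η + s * M).tendsto 0).mono_left nhdsWithin_le_nhds
    rw [zero_mul, add_zero] at this
    exact this.eventually_lt_const hη
  filter_upwards [h, self_mem_nhdsWithin] with s hs (hs0 : 0 < s)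
  refine ⟨hp.admissible.add_smul hq.admissible s, hp.smooth.add (hq.smooth.const_smul s),
    η + s * M, hs, fun x => ⟨?_, ?_⟩⟩
  · refine norm_add_le_of_le (hpη x).1 ?_
    rw [Pi.smul_apply, norm_smul, Real.norm_of_nonneg hs0.le]
    gcongr
    exact (hM x).1
  · have hqd := hq.smooth.differentiable (by simp) x
    rw [fderiv_add (hp.smooth.differentiable (by simp) x) (hqd.const_smul s),
      fderiv_const_smul hqd]
    refine norm_add_le_of_le (hpη x).2 ?_
    rw [norm_smul, Real.norm_of_nonneg hs0.le]
    gcongr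
    exact (hM x).2

/-- The bounds that define the family are strict, so each member has room for a further small
perturbation. Hyperbolicity and transversality of the section at the member itself give the
persistence. -/
lemma isRobustFamily_nearbyOrbits {f : StateSpace k → StateSpace k} (hf : G.IsAdmissible k f)
    (hfs : ContDiff ℝ ∞ f) {x : ℝ → StateSpace k} {T : ℝ} (hx : IsPeriodicSolution f x T)
    {t₀ : ℝ} {ℓ : StateSpace k →L[ℝ] ℝ} {ε δ : ℝ}
    (hyp : ∀ p y S, G.IsPerturbation k p ε → IsPerturbedOrbit f p x T t₀ ℓ δ y S →
      IsHyperbolicPeriodic (f + p) y S ∧ ℓ ((f + p) (y t₀)) ≠ 0) :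
    G.IsRobustFamily k (nearbyOrbits G k f x T t₀ ℓ ε δ) where
  admissible := by
    rintro _ y S ⟨p, rfl, hp, -⟩
    simpa using hf.add_smul hp.admissible 1
  smooth := by
    rintro _ y S ⟨p, rfl, hp, -⟩
    exact hfs.add hp.smooth
  periodicSolution := by
    rintro _ y S ⟨p, rfl, -, hy⟩
    exact hy.periodicSolution
  persistent := by
    rintro _ y S ⟨p, rfl, hp, hy⟩
    obtain ⟨hhyp, hsec⟩ := hyp p y S hp hy
    obtain ⟨K, hK, hpers⟩ := hhyp.exists_perturbed_orbit (F := f + p)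
      ((hfs.add hp.smooth).of_le (by exact_mod_cast le_top)) t₀ ℓ hsec
    refine ⟨K, hK, fun q hq B hB => ?_⟩
    obtain ⟨M, hM⟩ := hq.bounded
    have hB0 : 0 ≤ B := (intervalIntegral.integral_nonneg hy.periodicSolution.period_pos.le
      fun _ _ => norm_nonneg _).trans hB
    have hT := hx.period_pos
    -- The maximal distance over the compact period is attained, hence strictly below `δ`: this
    -- makes the slack uniform in `t`.
    obtain ⟨t₁, ht₁, hmax⟩ := isCompact_Icc.exists_isMaxOn
      (nonempty_Icc.2 (by linarith : t₀ ≤ t₀ + T))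
      ((hy.periodicSolution.continuous.sub hx.continuous).norm.continuousOn
        (s := Icc t₀ (t₀ + T)))
    have hlim : ∀ c d : ℝ, 0 < d → ∀ᶠ s in 𝓝[>] (0 : ℝ), K * B * s * c < d := by
      intro c d hd
      have : Tendsto (fun s : ℝ => K * B * s * c) (𝓝[>] 0) (𝓝 (K * B * 0 * c)) :=
        ((by fun_prop : Continuous fun s : ℝ => K * B * s * c).tendsto 0).mono_left
          nhdsWithin_le_nhds
      rw [mul_zero, zero_mul] at this
      exact this.eventually_lt_const hd
    filter_upwards [hpers q (hq.smooth.of_le (by exact_mod_cast le_top)) M (fun x => (hM x).1)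
      (fun x => (hM x).2) B hB, hp.eventually_add_smul hq,
      hlim 1 _ (sub_pos.2 hy.period_close),
      hlim (1 + (|t₀| + T)) _ (sub_pos.2 (hy.close t₁ ht₁)), self_mem_nhdsWithin]
      with s hs hps hs1 hs2 (hs0 : 0 < s)
    obtain ⟨Y, τ, hY, hYphase, hτ, hYy⟩ := hs
    rw [add_assoc] at hY
    refine ⟨Y, τ, ⟨p + s • q, add_assoc _ _ _, hps, hY, ?_, fun t ht => ?_, ?_⟩, hYy⟩
    · have := abs_sub_le τ S T
      linarith
    · have h1 : ‖Y t - y t‖ ≤ K * B * s * (1 + |t|) := by simpa using hYy 0 t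
      have h2 : ‖y t - x t‖ ≤ ‖y t₁ - x t₁‖ := hmax ht
      have h3 : |t| ≤ |t₀| + T := by
        have := abs_add_le t₀ (t - t₀)
        rw [abs_of_nonneg (sub_nonneg.2 ht.1), add_sub_cancel] at this
        linarith [ht.2]
      have h4 : K * B * s * (1 + |t|) ≤ K * B * s * (1 + (|t₀| + T)) := by gcongr
      have h5 := norm_sub_le_norm_sub_add_norm_sub (Y t) (y t) (x t)
      linarith
    · have h1 : Y t₀ - x t₀ = (Y t₀ - y t₀) + (y t₀ - x t₀) := by abel
      rw [h1, map_add, hYphase, hy.phase, add_zero]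

/-- For small perturbations the section stays transverse to the perturbed orbits. -/
lemma exists_forall_section_ne_zero {f : StateSpace k → StateSpace k} (hf : Continuous f)
    {x : ℝ → StateSpace k} {T : ℝ} (hT : 0 < T) {t₀ : ℝ} {ℓ : StateSpace k →L[ℝ] ℝ}
    (hℓ : IsSection f x t₀ ℓ) : ∃ ε > 0, ∃ δ > 0, ∀ p y S, G.IsPerturbation k p ε →
      IsPerturbedOrbit f p x T t₀ ℓ δ y S → ℓ ((f + p) (y t₀)) ≠ 0 := by
  have hm : 0 < |ℓ (f (x t₀))| := abs_pos.2 hℓ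
  set m := |ℓ (f (x t₀))| with hm'
  obtain ⟨δ, hδ, hball⟩ := Metric.continuousAt_iff.1
    ((ℓ.continuous.comp hf).continuousAt (x := x t₀)) (m / 2) (by positivity)
  refine ⟨m / (2 * (‖ℓ‖ + 1)), by positivity, δ, hδ, fun p y S hp hy h0 => ?_⟩
  have h1 : |ℓ (f (y t₀)) - ℓ (f (x t₀))| < m / 2 := by
    have := hball (x := y t₀)
      (by rw [dist_eq_norm]; exact hy.close t₀ ⟨le_rfl, by linarith⟩)
    rwa [Real.dist_eq] at this
  obtain ⟨η, hη, hpη⟩ := hp.small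
  have h2 : |ℓ (p (y t₀))| ≤ m / 2 := by
    have e1 : |ℓ (p (y t₀))| ≤ ‖ℓ‖ * (m / (2 * (‖ℓ‖ + 1))) :=
      ℓ.le_of_opNorm_le_of_le le_rfl ((hpη _).1.trans hη.le)
    have e2 : ‖ℓ‖ * (m / (2 * (‖ℓ‖ + 1))) = m / 2 * (‖ℓ‖ / (‖ℓ‖ + 1)) := by field_simp
    have e3 : ‖ℓ‖ / (‖ℓ‖ + 1) ≤ 1 := by
      rw [div_le_one (by positivity)]
      linarith
    rw [e2] at e1
    exact e1.trans (mul_le_of_le_one_right (by positivity) e3)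
  rw [Pi.add_apply, map_add] at h0
  have h3 : ℓ (f (x t₀)) = -(ℓ (f (y t₀)) - ℓ (f (x t₀))) - ℓ (p (y t₀)) := by linarith
  have h4 : m ≤ |ℓ (f (y t₀)) - ℓ (f (x t₀))| + |ℓ (p (y t₀))| := by
    have h5 := abs_sub (-(ℓ (f (y t₀)) - ℓ (f (x t₀)))) (ℓ (p (y t₀)))
    rwa [← h3, abs_neg] at h5
  linarith

/-- Local rigid phase relations of a periodic orbit imply input isomorphism. -/
theorem LocallyRigidlyPhaseRelated.inputIsomorphic [Fintype A] (hk : ∀ c, 1 ≤ k c)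
    {f : StateSpace k → StateSpace k} (hf : G.IsAdmissible k f) (hfs : ContDiff ℝ ∞ f)
    {x : ℝ → StateSpace k} {T : ℝ} (hx : IsPeriodicSolution f x T) {t₀ θ : ℝ} {c d : C}
    (h : G.LocallyRigidlyPhaseRelated k f x T t₀ θ c d) : G.InputIsomorphic c d := by
  obtain ⟨ε₁, hε₁, δ₁, hδ₁, r, hr, ℓ, hℓ, hrigid⟩ := h
  obtain ⟨ε₂, hε₂, δ₂, hδ₂, hsec⟩ :=
    exists_forall_section_ne_zero (G := G) hfs.continuous hx.period_pos hℓ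
  have hrob := isRobustFamily_nearbyOrbits (G := G) (t₀ := t₀) (ℓ := ℓ) (ε := min ε₁ ε₂)
    (δ := min δ₁ δ₂) hf hfs hx fun p y S hp hy =>
      ⟨(hrigid p (hp.mono (min_le_left _ _)) y S (hy.mono (min_le_left _ _))).1,
        hsec p y S (hp.mono (min_le_right _ _)) (hy.mono (min_le_right _ _))⟩
  have hε : 0 < min ε₁ ε₂ := lt_min hε₁ hε₂
  have hδ : 0 < min δ₁ δ₂ := lt_min hδ₁ hδ₂
  have hne : ∃ F y S, nearbyOrbits G k f x T t₀ ℓ (min ε₁ ε₂) (min δ₁ δ₂) F y S := by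
    -- The unperturbed orbit belongs to the family, with `p = 0`.
    refine ⟨f, x, T, 0, (add_zero f).symm,
      ⟨isAdmissible_zero hf.compatible, contDiff_const, 0, hε, fun x => by simp⟩, ?_, ?_, ?_, ?_⟩
    · rwa [add_zero]
    · simpa using hδ
    · intro t _
      simpa using hδ
    · simp
  refine Linked.inputIsomorphic (N := ∑ e, k e) (t₀ := t₀) (r := r) (θ := θ) ?_ hrob hne hk
    (fun e => Finset.single_le_sum (f := k) (fun _ _ => Nat.zero_le _) (Finset.mem_univ e)) hr
  rintro _ y S ⟨p, rfl, hp, hy⟩ t ht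
  have := (hrigid p (hp.mono (min_le_left _ _)) y S (hy.mono (min_le_left _ _))).2 t ht
  rw [zero_mul, add_zero]
  exact this.pad_eq

end Network

end

/-- The Local Rigid Input Property for strongly hyperbolic periodic orbits: nodes with the same
colour in a locally rigid synchrony pattern are input isomorphic, and so are any two nodes that are
locally rigidly phase-related (in particular, for `θ = 0`, locally rigidly synchronous). -/
theorem corollary10p4 {C A : Type*} [Fintype C] [Fintype A] (G : Network C A)
    (k : C → ℕ) (hk : ∀ c, 1 ≤ k c)
    (f : StateSpace k → StateSpace k) (hf : G.IsAdmissible k f) (hfs : ContDiff ℝ ∞ f)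
    (x : ℝ → StateSpace k) (T : ℝ) (hx : G.IsStronglyHyperbolic k f x T) :
    (∀ (t₀ : ℝ) (col : Setoid C), G.IsLocallyRigidPattern k f x T t₀ col →
      ∀ c d, col c d → G.InputIsomorphic c d) ∧
    (∀ (t₀ θ : ℝ) (c d : C), G.LocallyRigidlyPhaseRelated k f x T t₀ θ c d →
      G.InputIsomorphic c d) := by
  have hp := hx.1.periodicSolution
  refine ⟨fun t₀ col hcol c d hcd => ?_, fun t₀ θ c d h => h.inputIsomorphic hk hf hfs hp⟩
  obtain ⟨ε, hε, δ, hδ, r, hr, ℓ, hℓ, hrigid⟩ := hcol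
  have h : G.LocallyRigidlyPhaseRelated k f x T t₀ 0 c d := by
    refine ⟨ε, hε, δ, hδ, r, hr, ℓ, hℓ, fun p hp y S hy => ?_⟩
    obtain ⟨h1, h2⟩ := hrigid p hp y S hy
    refine ⟨h1, fun t ht => ?_⟩
    change SameState (y t c) (y (t + 0 * S) d)
    rw [zero_mul, add_zero]
    exact (h2 t ht c d).2 hcd
  exact h.inputIsomorphic hk hf hfs hp
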